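/- Let $(\mathcal M,g)$ be a time-oriented Lorentzian manifold (signature $(-,+,\dots,+)$, Levi-Civita connection $\nabla$) that is a convex normal neighborhood: any two events $p,q$ are joined by a unique geodesic, and $(p,v)\mapsto(p,\exp_p v)$ is a diffeomorphism from an open subset of $T\mathcal M$ onto $\mathcal M\times\mathcal M$; write $\log_p:=\exp_p^{-1}$. An observer $\beta$ and a test particle $\beta'$ are smooth future-pointing timelike curves, defined on open intervals and parametrized by proper time, with 4-velocities $U$, $U'$. Let $p=\beta(\tau_0)$ and $u:=U_p$. (a) For $\tau$ near $\tau_0$ let $q_{\mathrm s}(\tau)=\beta'(f(\tau))$ be an event of $\beta'$ that is joined to $\beta(\tau)$ by a spacelike geodesic orthogonal to $U$ at $\beta(\tau)$ (the case $q_{\mathrm s}(\tau)=\beta(\tau)$ is allowed), where the function $f$ is differentiable at $\tau_0$. Let $S(\tau):=\log_{\beta(\tau)}q_{\mathrm s}(\tau)$, $q_{\mathrm s}:=q_{\mathrm s}(\tau_0)$, $s:=S(\tau_0)$, $u'_{\mathrm s}:=U'_{q_{\mathrm s}}$, and assume that $\beta'$ is not tangent at $q_{\mathrm s}$ to the hypersurface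 $\{q: g(\log_p q,u)=0\}$ of the events simultaneous with $u$, i.e. that the derivative of $q\mapsto g(\log_p q,u)$ in the direction $u'_{\mathrm s}$ is nonzero. Then $S$ is differentiable at $\tau_0$, and the Fermi relative velocity $$v_{\mathrm{Fermi}}:=\big(\nabla_US+g(\nabla_US,U)\,U\big)_p$$ is completely determined by $p$, $q_{\mathrm s}$, $u$, $(\nabla_UU)_p$, $u'_{\mathrm s}$ and $s$: there is a function $\Phi$, depending only on the spacetime, with $v_{\mathrm{Fermi}}=\Phi\big(p,q_{\mathrm s},u,(\nabla_UU)_p,u'_{\mathrm s},s\big)$ for all such $\beta,\beta',f,\tau_0$. (b) For $\tau$ near $\tau_0$ let $q_\ell(\tau)=\beta'(f(\tau))$ be an event of $\beta'$ from which there is a light ray (a future-pointing lightlike geodesic) to $\beta(\tau)$ (the case $q_\ell(\tau)=\beta(\tau)$ is allowed), where the function $f$ is differentiable at $\tau_0$. Let $S_{\mathrm{obs}}(\tau):=\log_{\beta(\tau)}q_\ell(\tau)+g\big(\log_{\beta(\tau)}q_\ell(\tau),U\big)U$, $q_\ell:=q_\ell(\tau_0)$, $s_{\mathrm{obs}}:=S_{\mathrm{obs}}(\tau_0)$,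 $u'_\ell:=U'_{q_\ell}$. Then $S_{\mathrm{obs}}$ is differentiable at $\tau_0$, and the astrometric relative velocity $$v_{\mathrm{ast}}:=\big(\nabla_US_{\mathrm{obs}}+g(\nabla_US_{\mathrm{obs}},U)\,U\big)_p$$ is completely determined by $p$, $q_\ell$, $u$, $(\nabla_UU)_p$, $u'_\ell$ and $s_{\mathrm{obs}}$: there is a function $\Phi'$, depending only on the spacetime, with $v_{\mathrm{ast}}=\Phi'\big(p,q_\ell,u,(\nabla_UU)_p,u'_\ell,s_{\mathrm{obs}}\big)$ for all such $\beta,\beta',f,\tau_0$. In particular the evolution of $S$ or $S_{\mathrm{obs}}$ around $p$ need not be known. -/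

import Mathlib

open Set Filter Topology Bundle Manifold
open scoped ContDiff

noncomputable section

/-- A Lorentzian spacetime: a smooth symmetric tensor field `metric` of Lorentzian signature
`(-,+,…,+)` on the smooth manifold `M`, together with a time orientation, given by a continuous
timelike vector field. -/
structure Spacetime (E : Type*) [NormedAddCommGroup E] [NormedSpace ℝ E] (M : Type*)
    [TopologicalSpace M] [ChartedSpace E M] [IsManifold 𝓘(ℝ, E) ∞ M] where
  /-- The metric tensor `g`. -/
  metric (x : M) : TangentSpace 𝓘(ℝ, E) x →L[ℝ] TangentSpace 𝓘(ℝ, E) x →L[ℝ] ℝ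
  metric_symm (x : M) (v w : TangentSpace 𝓘(ℝ, E) x) : metric x v w = metric x w v
  metric_lorentz (x : M) : ∃ t : TangentSpace 𝓘(ℝ, E) x, metric x t t < 0 ∧
    ∀ v : TangentSpace 𝓘(ℝ, E) x, metric x t v = 0 → v ≠ 0 → 0 < metric x v v
  contMDiff_metric : ContMDiff 𝓘(ℝ, E) (𝓘(ℝ, E).prod 𝓘(ℝ, E →L[ℝ] E →L[ℝ] ℝ)) ∞
    (fun x ↦ TotalSpace.mk' (E →L[ℝ] E →L[ℝ] ℝ)
      (E := fun x : M ↦ TangentSpace 𝓘(ℝ, E) x →L[ℝ] TangentSpace 𝓘(ℝ, E) x →L[ℝ] ℝ) x (metric x))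
  /-- A timelike vector field that defines the future. -/
  future (x : M) : TangentSpace 𝓘(ℝ, E) x
  metric_future (x : M) : metric x (future x) (future x) < 0
  continuous_future : Continuous (fun x : M ↦ (⟨x, future x⟩ : TangentBundle 𝓘(ℝ, E) M))

section Curves

variable {E : Type*} [NormedAddCommGroup E] [NormedSpace ℝ E] {M : Type*}
  [TopologicalSpace M] [ChartedSpace E M]

/-- The tangent vector of the curve `γ` at the parameter `t`. -/
def curveVelocity (γ : ℝ → M) (t : ℝ) : TangentSpace 𝓘(ℝ, E) (γ t) :=
  mfderiv 𝓘(ℝ, ℝ) 𝓘(ℝ, E) γ t (1 : ℝ)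

variable [IsManifold 𝓘(ℝ, E) ∞ M]

/-- The components of the vector field `V` along the curve `γ`, in the frame of coordinate vector
fields of the preferred chart at the point `γ t₀`. -/
def curveComponents (γ : ℝ → M) (V : ∀ t, TangentSpace 𝓘(ℝ, E) (γ t)) (t₀ t : ℝ) : E :=
  (trivializationAt E (TangentSpace 𝓘(ℝ, E) : M → Type _) (γ t₀)
    (⟨γ t, V t⟩ : TangentBundle 𝓘(ℝ, E) M)).2

/-- The vector field `V` along the curve `γ` is differentiable at `t₀`, as a curve in the tangent
bundle. -/
def CurveFieldDifferentiableAt (γ : ℝ → M) (V : ∀ t, TangentSpace 𝓘(ℝ, E) (γ t)) (t₀ : ℝ) : Prop :=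
  MDifferentiableAt 𝓘(ℝ, ℝ) 𝓘(ℝ, E).tangent
    (fun t ↦ (⟨γ t, V t⟩ : TangentBundle 𝓘(ℝ, E) M)) t₀

end Curves

namespace Spacetime

variable {E : Type*} [NormedAddCommGroup E] [NormedSpace ℝ E] {M : Type*}
  [TopologicalSpace M] [ChartedSpace E M] [IsManifold 𝓘(ℝ, E) ∞ M] (S : Spacetime E M)

/-- The value at `a`, `b` of the metric in the preferred chart at `x₀` (the components `g_{jk}`, for
coordinate vectors `a`, `b`), as a function of the coordinates `y`. -/
def chartMetric (x₀ : M) (a b : E) (y : E) : ℝ :=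
  S.metric ((extChartAt 𝓘(ℝ, E) x₀).symm y)
    ((trivializationAt E (TangentSpace 𝓘(ℝ, E)) x₀).symmL ℝ ((extChartAt 𝓘(ℝ, E) x₀).symm y) a)
    ((trivializationAt E (TangentSpace 𝓘(ℝ, E)) x₀).symmL ℝ ((extChartAt 𝓘(ℝ, E) x₀).symm y) b)

/-- `∂_c g(a, b)` at the point `x₀`, in the preferred chart at `x₀`. -/
def chartMetricDeriv (x₀ : M) (c a b : E) : ℝ :=
  fderiv ℝ (S.chartMetric x₀ a b) (extChartAt 𝓘(ℝ, E) x₀ x₀) c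

/-- The Christoffel symbols `Γ(a, b) = Γ^i_{jk} a^j b^k` of the Levi-Civita connection at `x₀`, in
the preferred chart at `x₀`: the coordinate vector `w` with
`2 g(w, c) = ∂_a g(b, c) + ∂_b g(a, c) - ∂_c g(a, b)` for all `c`; it exists and is unique, because
`g` is smooth and nondegenerate. -/
def christoffel (x₀ : M) (a b : E) : E :=
  Classical.epsilon fun w : E ↦ ∀ c : E,
    2 * S.chartMetric x₀ w c (extChartAt 𝓘(ℝ, E) x₀ x₀) =
      S.chartMetricDeriv x₀ a b c + S.chartMetricDeriv x₀ b a c - S.chartMetricDeriv x₀ c a b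

/-- The Levi-Civita covariant derivative along the curve `γ`, at `t₀`, of the vector field `V` along
`γ`: the vector with components `dV^i/dt + Γ^i_{jk} γ'^j V^k` in the preferred chart at `γ t₀`. -/
def covDeriv (γ : ℝ → M) (V : ∀ t, TangentSpace 𝓘(ℝ, E) (γ t)) (t₀ : ℝ) :
    TangentSpace 𝓘(ℝ, E) (γ t₀) :=
  (trivializationAt E (TangentSpace 𝓘(ℝ, E)) (γ t₀)).symmL ℝ (γ t₀)
    (deriv (curveComponents γ V t₀) t₀ +
      S.christoffel (γ t₀) (curveComponents γ (fun t ↦ curveVelocity γ t) t₀ t₀)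
        (curveComponents γ V t₀ t₀))

/-- `γ` is a (smooth, affinely parametrized, possibly constant) geodesic on `[0, 1]`. -/
def IsGeodesicSegment (γ : ℝ → M) : Prop :=
  ∀ t ∈ Icc (0 : ℝ) 1, ContMDiffAt 𝓘(ℝ, ℝ) 𝓘(ℝ, E) ∞ γ t ∧
    S.covDeriv γ (fun t ↦ curveVelocity γ t) t = 0

/-- The geodesic with initial tangent vector `x` (a vector together with its base point) is defined
on `[0, 1]` and ends at `q`. -/
def GeodesicReaches (x : TangentBundle 𝓘(ℝ, E) M) (q : M) : Prop :=
  ∃ γ : ℝ → M, S.IsGeodesicSegment γ ∧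
    (⟨γ 0, curveVelocity γ 0⟩ : TangentBundle 𝓘(ℝ, E) M) = x ∧ γ 1 = q

/-- The domain of the exponential map of all of `M`. -/
def expDomain : Set (TangentBundle 𝓘(ℝ, E) M) := {x | ∃ q, S.GeodesicReaches x q}

open Classical in
/-- The exponential map `exp_p v`, as a map on the tangent bundle (with a junk value outside of
`expDomain`). -/
def exp (x : TangentBundle 𝓘(ℝ, E) M) : M :=
  if h : ∃ q, S.GeodesicReaches x q then h.choose else x.1

open Classical in
/-- `log_p q`, the initial tangent vector of a geodesic from `p` to `q` that is parametrized by
`[0, 1]` (with a junk value if there is none). -/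
def log (p q : M) : TangentSpace 𝓘(ℝ, E) p :=
  if h : ∃ v : TangentSpace 𝓘(ℝ, E) p, S.GeodesicReaches ⟨p, v⟩ q then h.choose else 0

/-- The whole spacetime is a convex normal neighborhood: any two events `p`, `q` are joined by a
unique geodesic, and `(p, v) ↦ (p, exp_p v)` is a diffeomorphism from an open subset of the tangent
bundle onto `M × M`, with inverse `(p, q) ↦ (p, log_p q)`. -/
structure IsConvexNormal : Prop where
  existsUnique_geodesic (p q : M) : ∃! v : TangentSpace 𝓘(ℝ, E) p, S.GeodesicReaches ⟨p, v⟩ q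
  isOpen_expDomain : IsOpen S.expDomain
  contMDiffOn_exp : ContMDiffOn 𝓘(ℝ, E).tangent 𝓘(ℝ, E) ∞ S.exp S.expDomain
  exp_log (p q : M) : S.exp ⟨p, S.log p q⟩ = q
  contMDiff_log : ContMDiff (𝓘(ℝ, E).prod 𝓘(ℝ, E)) 𝓘(ℝ, E).tangent ∞
    (fun x : M × M ↦ (⟨x.1, S.log x.1 x.2⟩ : TangentBundle 𝓘(ℝ, E) M))

/-- The world line of an observer or of a test particle, on the open interval `I` and parametrized by
proper time: its 4-velocity is unit timelike and future-pointing. -/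
structure IsWorldLine (β : ℝ → M) (I : Set ℝ) : Prop where
  isOpen : IsOpen I
  ordConnected : I.OrdConnected
  contMDiffOn : ContMDiffOn 𝓘(ℝ, ℝ) 𝓘(ℝ, E) ∞ β I
  unit (t : ℝ) (ht : t ∈ I) : S.metric (β t) (curveVelocity β t) (curveVelocity β t) = -1
  future_pointing (t : ℝ) (ht : t ∈ I) : S.metric (β t) (S.future (β t)) (curveVelocity β t) < 0

/-- There is a spacelike geodesic, orthogonal to the vector `u` at `p`, that joins `p` and `q` (the
zero vector is spacelike, so that `q = p` is allowed). -/
def IsSimultaneous (p : M) (u : TangentSpace 𝓘(ℝ, E) p) (q : M) : Prop :=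
  ∃ v : TangentSpace 𝓘(ℝ, E) p, S.GeodesicReaches ⟨p, v⟩ q ∧
    (0 < S.metric p v v ∨ v = 0) ∧ S.metric p v u = 0

/-- There is a light ray from `q` to `p`: a future-pointing lightlike geodesic from `q` to `p`, where
`q = p` is allowed. -/
def IsLightRay (q p : M) : Prop :=
  q = p ∨ ∃ w : TangentSpace 𝓘(ℝ, E) q, S.GeodesicReaches ⟨q, w⟩ p ∧
    w ≠ 0 ∧ S.metric q w w = 0 ∧ S.metric q (S.future q) w < 0

/-- The observed relative position of `q` with respect to `u`: the projection of `log_p q` onto the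
orthogonal space of the unit timelike vector `u`. -/
def obsPosition (p : M) (u : TangentSpace 𝓘(ℝ, E) p) (q : M) : TangentSpace 𝓘(ℝ, E) p :=
  S.log p q + S.metric p (S.log p q) u • u

/-- The relative position `S` of the test particle `β'` with respect to the observer `β`, as a vector
field along `β`; the proper time of `β'` that corresponds to the proper time `τ` of `β` is `f τ`. -/
def relPositionField (β β' : ℝ → M) (f : ℝ → ℝ) (τ : ℝ) : TangentSpace 𝓘(ℝ, E) (β τ) :=
  S.log (β τ) (β' (f τ))

/-- The observed relative position `S_obs` of the test particle `β'` with respect to the observer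
`β`, as a vector field along `β`; the proper time of `β'` that corresponds to the proper time `τ` of
`β` is `f τ`. -/
def obsPositionField (β β' : ℝ → M) (f : ℝ → ℝ) (τ : ℝ) : TangentSpace 𝓘(ℝ, E) (β τ) :=
  S.obsPosition (β τ) (curveVelocity β τ) (β' (f τ))

/-- The acceleration `∇_U U` of the observer `β`. -/
def acceleration (β : ℝ → M) (τ : ℝ) : TangentSpace 𝓘(ℝ, E) (β τ) :=
  S.covDeriv β (fun t ↦ curveVelocity β t) τ

/-- The projection of `∇_U V` onto the orthogonal space of the 4-velocity `U` of `β`, for a vector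
field `V` along `β`. -/
def projCovDeriv (β : ℝ → M) (V : ∀ t, TangentSpace 𝓘(ℝ, E) (β t)) (τ : ℝ) :
    TangentSpace 𝓘(ℝ, E) (β τ) :=
  S.covDeriv β V τ + S.metric (β τ) (S.covDeriv β V τ) (curveVelocity β τ) • curveVelocity β τ

/-- The Fermi relative velocity of `β'` with respect to `β`. -/
def fermiVelocity (β β' : ℝ → M) (f : ℝ → ℝ) (τ : ℝ) : TangentSpace 𝓘(ℝ, E) (β τ) :=
  S.projCovDeriv β (S.relPositionField β β' f) τ

/-- The astrometric relative velocity of `β'` with respect to `β`. -/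
def astrometricVelocity (β β' : ℝ → M) (f : ℝ → ℝ) (τ : ℝ) : TangentSpace 𝓘(ℝ, E) (β τ) :=
  S.projCovDeriv β (S.obsPositionField β β' f) τ

/-- The curve `β'` is not tangent at `β' t₀` to the hypersurface of the events simultaneous with
`u`, `{q | g(log_p q, u) = 0}`: the derivative of `g(log_p q, u)` along `β'` is nonzero there. -/
def CrossesSimultaneity (p : M) (u : TangentSpace 𝓘(ℝ, E) p) (β' : ℝ → M) (t₀ : ℝ) : Prop :=
  deriv (fun t ↦ S.metric p (S.log p (β' t)) u) t₀ ≠ 0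

end Spacetime

end

/-! Write S(τ) = log(β(τ), β'(f(τ))). By the chain rule, ∇_U S at p is D₁log(u) + f'(τ) D₂log(u') +
Γ(u, log_p q), so the number f'(τ) is the only ingredient that is not visibly a function of the
pointwise data. It is recovered by differentiating the constraint that ties q to the observer, which
is affine in f'(τ); the question is whether its leading coefficient is nonzero.

Fermi case: g(S, U) = 0 gives g(∇_U S, u) + g(s, ∇_U U) = 0. The coefficient g(D₂log(u'), u) is
nonzero exactly by the transversality assumption.

Astrometric case: g(S, S) = 0 gives g(∇_U S, S) = 0, with coefficient g(D₂log(u'), log_p q). If q ≠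
p, the Gauss lemma turns this into the product of u' with the end velocity of the geodesic from p to
q; the first is timelike and the second is lightlike and nonzero, so they cannot be orthogonal
(`form_logDeriv_ne_zero`). If q = p, the equation is void. Then S is zero at τ and lightlike
past-pointing or zero nearby; comparing the one-sided difference quotients forces ∇_U S = 0
(`covDeriv_eq_zero_of_null`). The Leibniz rule for S_obs = S + g(S, U) U finishes.

The supporting theory is metric compatibility and absence of torsion for a connection given by
Christoffel symbols, and the Gauss lemma. Uniqueness for the geodesic equation is never invoked: the
uniqueness of the geodesic between two events takes its place. -/

noncomputable section

set_option maxSynthPendingDepth 3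

/-! ### Components of tangent vectors in a chart -/

section TangentCoordinates

theorem eventually_mem_chart {E : Type*} [NormedAddCommGroup E] {M : Type*} [TopologicalSpace M]
    [ChartedSpace E M] {γ : ℝ → M} {t : ℝ}
    (hγ : ContinuousAt γ t) :
    ∀ᶠ s in 𝓝 t, γ s ∈ (chartAt E (γ t)).source :=
  hγ.eventually ((chartAt E (γ t)).open_source.mem_nhds (mem_chart_source E (γ t)))

variable {E : Type*} [NormedAddCommGroup E] [NormedSpace ℝ E] {M : Type*}
  [TopologicalSpace M] [ChartedSpace E M] [IsManifold 𝓘(ℝ, E) ∞ M]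

/-- The components of the tangent vector `v` at `x` in the preferred chart at `x₀`. -/
def tangentCoord (x₀ x : M) (v : TangentSpace 𝓘(ℝ, E) x) : E :=
  (trivializationAt E (TangentSpace 𝓘(ℝ, E) : M → Type _) x₀
    (⟨x, v⟩ : TangentBundle 𝓘(ℝ, E) M)).2

theorem tangentCoord_eq {x₀ x : M} (hx : x ∈ (chartAt E x₀).source)
    (v : TangentSpace 𝓘(ℝ, E) x) : tangentCoord x₀ x v =
      (trivializationAt E (TangentSpace 𝓘(ℝ, E) : M → Type _) x₀).continuousLinearMapAt ℝ x v := by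
  rw [Trivialization.continuousLinearMapAt_apply, Trivialization.linearMapAt_apply,
    if_pos (show x ∈ Trivialization.baseSet _ from hx)]
  rfl

theorem tangentCoord_add {x₀ x : M} (hx : x ∈ (chartAt E x₀).source)
    (v w : TangentSpace 𝓘(ℝ, E) x) :
    tangentCoord x₀ x (v + w) = tangentCoord x₀ x v + tangentCoord x₀ x w := by
  simp only [tangentCoord_eq hx, map_add]

theorem tangentCoord_smul {x₀ x : M} (hx : x ∈ (chartAt E x₀).source) (c : ℝ)
    (v : TangentSpace 𝓘(ℝ, E) x) : tangentCoord x₀ x (c • v) = c • tangentCoord x₀ x v := by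
  simp only [tangentCoord_eq hx, map_smul]

theorem symmL_tangentCoord {x₀ x : M} (hx : x ∈ (chartAt E x₀).source)
    (v : TangentSpace 𝓘(ℝ, E) x) :
    (trivializationAt E (TangentSpace 𝓘(ℝ, E)) x₀).symmL ℝ x (tangentCoord x₀ x v) = v := by
  rw [tangentCoord_eq hx]
  exact Trivialization.symmL_continuousLinearMapAt _ hx v

-- At its own base point the preferred chart induces the identity on the model space. This lets
-- tangent vectors at the base point be treated as elements of `E`, where most later identities are
-- stated.
@[simp]
theorem tangentCoord_self (x : M) (v : TangentSpace 𝓘(ℝ, E) x) : tangentCoord x x v = v := by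
  rw [tangentCoord_eq (mem_chart_source E x),
    TangentBundle.continuousLinearMapAt_trivializationAt_eq_core (mem_chart_source E x)]
  exact (tangentBundleCore 𝓘(ℝ, E) M).coordChange_self _ _ (mem_chart_source E x) v

theorem symmL_self (x : M) (v : E) :
    (trivializationAt E (TangentSpace 𝓘(ℝ, E)) x).symmL ℝ x v = (v : TangentSpace 𝓘(ℝ, E) x) := by
  exact (congrArg ((trivializationAt E (TangentSpace 𝓘(ℝ, E)) x).symmL ℝ x)
    (tangentCoord_self x v).symm).trans (symmL_tangentCoord (mem_chart_source E x) v)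

theorem tangentCoord_mfderiv {x₀ x : M} (hx : x ∈ (chartAt E x₀).source) {F : Type*}
    [NormedAddCommGroup F] [NormedSpace ℝ F] {h : F → M} {z : F} (hz : h z = x)
    (hh : MDifferentiableAt 𝓘(ℝ, F) 𝓘(ℝ, E) h z) (w : F) :
    tangentCoord x₀ (h z) (mfderiv 𝓘(ℝ, F) 𝓘(ℝ, E) h z w) =
      fderiv ℝ (extChartAt 𝓘(ℝ, E) x₀ ∘ h) z w := by
  subst hz
  rw [tangentCoord_eq hx, TangentBundle.continuousLinearMapAt_trivializationAt hx,
    ← mfderiv_eq_fderiv, mfderiv_comp z (mdifferentiableAt_extChartAt hx) hh]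
  rfl

theorem tangentCoord_curveVelocity {x₀ : M} {γ : ℝ → M} {t : ℝ} (hx : γ t ∈ (chartAt E x₀).source)
    (hγ : MDifferentiableAt 𝓘(ℝ, ℝ) 𝓘(ℝ, E) γ t) :
    tangentCoord x₀ (γ t) (curveVelocity γ t) = deriv (extChartAt 𝓘(ℝ, E) x₀ ∘ γ) t := by
  rw [curveVelocity, tangentCoord_mfderiv hx rfl hγ]
  simp

theorem hasDerivAt_extChartAt_comp {γ : ℝ → M} {t : ℝ}
    (hγ : MDifferentiableAt 𝓘(ℝ, ℝ) 𝓘(ℝ, E) γ t) :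
    HasDerivAt (extChartAt 𝓘(ℝ, E) (γ t) ∘ γ) (curveVelocity γ t : E) t := by
  have h := tangentCoord_curveVelocity (mem_chart_source E (γ t)) hγ
  rw [tangentCoord_self] at h
  rw [h]
  refine DifferentiableAt.hasDerivAt ?_
  rw [← mdifferentiableAt_iff_differentiableAt]
  exact (mdifferentiableAt_extChartAt (mem_chart_source E (γ t))).comp t hγ

theorem curveFieldDifferentiableAt_iff {γ : ℝ → M}
    {V : ∀ t, TangentSpace 𝓘(ℝ, E) (γ t)} {t₀ : ℝ} :
    CurveFieldDifferentiableAt γ V t₀ ↔ MDifferentiableAt 𝓘(ℝ, ℝ) 𝓘(ℝ, E) γ t₀ ∧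
      DifferentiableAt ℝ (fun t ↦ tangentCoord (γ t₀) (γ t) (V t)) t₀ := by
  rw [CurveFieldDifferentiableAt, ← mdifferentiableAt_iff_differentiableAt]
  exact mdifferentiableAt_totalSpace 𝓘(ℝ, E) _

theorem eventually_mdifferentiableAt {γ : ℝ → M} {t : ℝ}
    (hγ : ContMDiffAt 𝓘(ℝ, ℝ) 𝓘(ℝ, E) 2 γ t) :
    ∀ᶠ s in 𝓝 t, MDifferentiableAt 𝓘(ℝ, ℝ) 𝓘(ℝ, E) γ s := by
  have h := (contMDiffAt_iff_contMDiffAt_nhds (I := 𝓘(ℝ, ℝ)) (I' := 𝓘(ℝ, E)) (n := 1)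
    (by simp)).1 (hγ.of_le (by norm_num))
  exact h.mono fun s hs ↦ hs.mdifferentiableAt (by simp)

omit [IsManifold 𝓘(ℝ, E) ∞ M] in
theorem contDiffAt_extChartAt_comp {F : Type*} [NormedAddCommGroup F] [NormedSpace ℝ F]
    {h : F → M} {z : F} (hh : ContMDiffAt 𝓘(ℝ, F) 𝓘(ℝ, E) 2 h z) :
    ContDiffAt ℝ 2 (extChartAt 𝓘(ℝ, E) (h z) ∘ h) z := by
  rw [← contMDiffAt_iff_contDiffAt]
  exact (contMDiffAt_extChartAt (I := 𝓘(ℝ, E)) (n := 2) (x := h z)).comp z hh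

theorem curveVelocity_differentiable {γ : ℝ → M} {t : ℝ}
    (hγ : ContMDiffAt 𝓘(ℝ, ℝ) 𝓘(ℝ, E) 2 γ t) :
    CurveFieldDifferentiableAt γ (fun s ↦ (curveVelocity γ s : TangentSpace 𝓘(ℝ, E) (γ s))) t := by
  have hd := hγ.mdifferentiableAt (by simp)
  rw [curveFieldDifferentiableAt_iff]
  refine ⟨hd, ?_⟩
  have h1 := contDiffAt_extChartAt_comp hγ
  have h2 : DifferentiableAt ℝ (deriv (extChartAt 𝓘(ℝ, E) (γ t) ∘ γ)) t := by
    have := (h1.fderiv_right (m := 1) (by norm_num)).differentiableAt (by simp)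
    exact this.clm_apply (differentiableAt_const _)
  refine h2.congr_of_eventuallyEq ?_
  filter_upwards [eventually_mem_chart (E := E) hγ.continuousAt, eventually_mdifferentiableAt hγ]
    with s hs hs'
  exact tangentCoord_curveVelocity hs hs'

end TangentCoordinates

namespace Spacetime

variable {E : Type*} [NormedAddCommGroup E] [NormedSpace ℝ E] {M : Type*}
  [TopologicalSpace M] [ChartedSpace E M] [IsManifold 𝓘(ℝ, E) ∞ M] (S : Spacetime E M)

/-! ### The metric in coordinates -/

section CoordinateMetric

/-- The metric at `x`, as a bilinear form on the model space of the tangent space. -/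
def form (x : M) : E →L[ℝ] E →L[ℝ] ℝ := S.metric x

theorem metric_eq_form (x : M) (v w : TangentSpace 𝓘(ℝ, E) x) :
    S.metric x v w = S.form x v w := rfl

theorem form_symm (x : M) (v w : E) : S.form x v w = S.form x w v := S.metric_symm x v w

/-- The metric in the preferred chart at `x₀`, as a function of the coordinates. -/
def coordMetric (x₀ : M) (y : E) : E →L[ℝ] E →L[ℝ] ℝ :=
  (S.form ((extChartAt 𝓘(ℝ, E) x₀).symm y)).bilinearComp
    (show E →L[ℝ] E from (trivializationAt E (TangentSpace 𝓘(ℝ, E)) x₀).symmL ℝ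
      ((extChartAt 𝓘(ℝ, E) x₀).symm y))
    (show E →L[ℝ] E from (trivializationAt E (TangentSpace 𝓘(ℝ, E)) x₀).symmL ℝ
      ((extChartAt 𝓘(ℝ, E) x₀).symm y))

theorem coordMetric_apply (x₀ : M) (y a b : E) :
    S.coordMetric x₀ y a b = S.chartMetric x₀ a b y :=
  ContinuousLinearMap.bilinearComp_apply _ _ _ _ _

theorem metric_eq_coordMetric {x₀ x : M} (hx : x ∈ (chartAt E x₀).source)
    (v w : TangentSpace 𝓘(ℝ, E) x) : S.metric x v w =
      S.coordMetric x₀ (extChartAt 𝓘(ℝ, E) x₀ x) (tangentCoord x₀ x v) (tangentCoord x₀ x w) := by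
  have h : (extChartAt 𝓘(ℝ, E) x₀).symm (extChartAt 𝓘(ℝ, E) x₀ x) = x :=
    (extChartAt 𝓘(ℝ, E) x₀).left_inv (by simpa using hx)
  rw [coordMetric_apply, chartMetric, h, symmL_tangentCoord hx, symmL_tangentCoord hx]

theorem coordMetric_self (x : M) (v w : E) :
    S.coordMetric x (extChartAt 𝓘(ℝ, E) x x) v w = S.form x v w := by
  have h := S.metric_eq_coordMetric (mem_chart_source E x) v w
  rw [tangentCoord_self x v, tangentCoord_self x w] at h
  exact h.symm

theorem chartMetricDeriv_symm (x₀ : M) (c a b : E) :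
    S.chartMetricDeriv x₀ c a b = S.chartMetricDeriv x₀ c b a := by
  have : S.chartMetric x₀ a b = S.chartMetric x₀ b a :=
    funext fun y ↦ S.metric_symm _ _ _
  rw [chartMetricDeriv, chartMetricDeriv, this]

/-- These are the coordinate vector fields: their components in the trivialization are constant. -/
theorem contMDiffOn_symmL (x₀ : M) (a : E) : ContMDiffOn 𝓘(ℝ, E) 𝓘(ℝ, E).tangent ∞
    (fun x ↦ (⟨x, (trivializationAt E (TangentSpace 𝓘(ℝ, E)) x₀).symmL ℝ x a⟩ :
      TangentBundle 𝓘(ℝ, E) M)) (chartAt E x₀).source := by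
  refine ((trivializationAt E (TangentSpace 𝓘(ℝ, E)) x₀).contMDiffOn_section_baseSet_iff
    (IB := 𝓘(ℝ, E)) (n := ∞)).2 ?_
  refine (contMDiffOn_const (c := a)).congr fun x hx ↦ ?_
  have := Trivialization.continuousLinearMapAt_symmL (R := ℝ)
    (trivializationAt E (TangentSpace 𝓘(ℝ, E)) x₀) hx a
  rwa [← tangentCoord_eq hx] at this

variable [FiniteDimensional ℝ E]

/-- In finite dimension, smoothness of a bilinear-form-valued map can be tested on fixed pairs of
vectors, and there it is the smooth metric contracted with two coordinate fields. -/
theorem contDiffOn_coordMetric (x₀ : M) :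
    ContDiffOn ℝ ∞ (S.coordMetric x₀) (extChartAt 𝓘(ℝ, E) x₀).target := by
  refine contDiffOn_clm_apply.2 fun a ↦ contDiffOn_clm_apply.2 fun b ↦ ?_
  rw [← contMDiffOn_iff_contDiffOn]
  have h : ContMDiffOn 𝓘(ℝ, E) 𝓘(ℝ, ℝ) ∞ (fun x ↦ S.metric x
      ((trivializationAt E (TangentSpace 𝓘(ℝ, E)) x₀).symmL ℝ x a)
      ((trivializationAt E (TangentSpace 𝓘(ℝ, E)) x₀).symmL ℝ x b)) (chartAt E x₀).source := by
    have h1 : ContMDiffOn 𝓘(ℝ, E) (𝓘(ℝ, E).prod 𝓘(ℝ, ℝ)) ∞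
        (fun x : M ↦ TotalSpace.mk' ℝ (E := Bundle.Trivial M ℝ) x (S.metric x
      ((trivializationAt E (TangentSpace 𝓘(ℝ, E)) x₀).symmL ℝ x a)
      ((trivializationAt E (TangentSpace 𝓘(ℝ, E)) x₀).symmL ℝ x b))) (chartAt E x₀).source := by
      apply ContMDiffOn.clm_bundle_apply₂ (F₁ := E) (F₂ := E)
      · exact S.contMDiff_metric.contMDiffOn
      · exact contMDiffOn_symmL x₀ a
      · exact contMDiffOn_symmL x₀ b
    intro x hx
    exact (contMDiffWithinAt_totalSpace.1 (h1 x hx)).2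
  refine h.comp (contMDiffOn_extChartAt_symm x₀) fun y hy ↦ ?_
  simpa using (extChartAt 𝓘(ℝ, E) x₀).map_target hy

theorem hasFDerivAt_coordMetric (x₀ : M) :
    HasFDerivAt (S.coordMetric x₀)
      (fderiv ℝ (S.coordMetric x₀) (extChartAt 𝓘(ℝ, E) x₀ x₀)) (extChartAt 𝓘(ℝ, E) x₀ x₀) :=
  (((S.contDiffOn_coordMetric x₀).differentiableOn (by simp)).differentiableAt
    (extChartAt_target_mem_nhds x₀)).hasFDerivAt

theorem chartMetricDeriv_eq (x₀ : M) (c a b : E) : S.chartMetricDeriv x₀ c a b =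
    fderiv ℝ (S.coordMetric x₀) (extChartAt 𝓘(ℝ, E) x₀ x₀) c a b := by
  have h := ((S.hasFDerivAt_coordMetric x₀).clm_apply
    (hasFDerivAt_const a _)).clm_apply (hasFDerivAt_const b _)
  have h2 : HasFDerivAt (S.chartMetric x₀ a b) _ _ := h
  rw [chartMetricDeriv, h2.fderiv]
  simp

end CoordinateMetric

/-! ### Lorentzian linear algebra -/

section Algebra

/-- The orthogonal complement of a timelike vector is spacelike. -/
theorem metric_pos_of_orthogonal {x : M} {u v : TangentSpace 𝓘(ℝ, E) x}
    (hu : S.metric x u u < 0) (huv : S.metric x u v = 0) (hv : v ≠ 0) : 0 < S.metric x v v := by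
  obtain ⟨t, -, ht⟩ := S.metric_lorentz x
  by_contra! h
  -- The combination of `u` and `v` orthogonal to `t`. If `v` were not spacelike, g(w, w) ≤ 0 would
  -- force w = 0, hence g(t, v) = 0, and then `v` would be spacelike after all.
  set w := S.metric x t v • u - S.metric x t u • v with hw
  have hvu : S.metric x v u = 0 := by rw [S.metric_symm, huv]
  have h1 : S.metric x t w = 0 := by
    simp only [hw, map_sub, map_smul, smul_eq_mul]; ring
  have h2 : S.metric x w w =
      S.metric x t v ^ 2 * S.metric x u u + S.metric x t u ^ 2 * S.metric x v v := by
    simp only [hw, map_sub, map_smul, smul_eq_mul, sub_apply,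
      smul_apply, huv, hvu]
    ring
  have h3 : w = 0 := by
    by_contra hne
    have := ht w h1 hne
    nlinarith [mul_nonneg (sq_nonneg (S.metric x t v)) (neg_nonneg.2 hu.le),
      mul_nonneg (sq_nonneg (S.metric x t u)) (neg_nonneg.2 h)]
  have h4 : S.metric x t v = 0 := by
    have h5 : S.metric x w w = 0 := by simp [h3]
    by_contra hne
    have : 0 < S.metric x t v ^ 2 := by positivity
    nlinarith [mul_nonneg (sq_nonneg (S.metric x t u)) (neg_nonneg.2 h)]
  exact absurd (ht v h4 hv) (not_lt.2 h)

theorem metric_ne_zero_of_null {x : M} {u v : TangentSpace 𝓘(ℝ, E) x}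
    (hu : S.metric x u u < 0) (hv : S.metric x v v = 0) (hv0 : v ≠ 0) : S.metric x u v ≠ 0 :=
  fun h ↦ (S.metric_pos_of_orthogonal hu h hv0).ne' hv

/-- A vector in the radical would be lightlike and orthogonal to the timelike field `future`. -/
theorem eq_zero_of_forall_metric_eq_zero {x : M} {v : TangentSpace 𝓘(ℝ, E) x}
    (h : ∀ w, S.metric x v w = 0) : v = 0 := by
  by_contra hv
  exact S.metric_ne_zero_of_null (S.metric_future x) (h v) hv ((S.metric_symm _ _ _).trans (h _))

end Algebra

/-! ### Christoffel symbols -/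

section Christoffel

variable [FiniteDimensional ℝ E]

theorem exists_form_eq (x : M) (l : E →L[ℝ] ℝ) : ∃ w : E, ∀ c : E, S.form x w c = l c := by
  let f : E →ₗ[ℝ] Module.Dual ℝ E :=
    { toFun := fun w ↦ (S.form x w).toLinearMap
      map_add' := fun a b ↦ by ext c; simp
      map_smul' := fun r a ↦ by ext c; simp }
  have hf : Function.Injective f := by
    rw [← LinearMap.ker_eq_bot, LinearMap.ker_eq_bot']
    intro w hw
    exact S.eq_zero_of_forall_metric_eq_zero (x := x) (v := w)
      fun c ↦ congrArg (fun m : Module.Dual ℝ E ↦ m c) hw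
  obtain ⟨w, hw⟩ := (LinearMap.injective_iff_surjective_of_finrank_eq_finrank
    (Subspace.dual_finrank_eq (K := ℝ) (V := E)).symm).1 hf l.toLinearMap
  exact ⟨w, fun c ↦ congrArg (fun m : Module.Dual ℝ E ↦ m c) hw⟩

/-- `christoffel` is chosen by `Classical.epsilon`, so a solution of the Koszul formula has to be
exhibited: nondegeneracy represents the functional of `c` on the right by a vector. -/
theorem christoffel_spec (x : M) (a b c : E) :
    2 * S.form x (S.christoffel x a b) c =
      S.chartMetricDeriv x a b c + S.chartMetricDeriv x b a c - S.chartMetricDeriv x c a b := by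
  have hex : ∃ w : E, ∀ c : E, 2 * S.chartMetric x w c (extChartAt 𝓘(ℝ, E) x x) =
      S.chartMetricDeriv x a b c + S.chartMetricDeriv x b a c - S.chartMetricDeriv x c a b := by
    let D := fderiv ℝ (S.coordMetric x) (extChartAt 𝓘(ℝ, E) x x)
    obtain ⟨w, hw⟩ := S.exists_form_eq x
      ((1 / 2 : ℝ) • (D a b + D b a - (D.flip a).flip b))
    refine ⟨w, fun c ↦ ?_⟩
    rw [← coordMetric_apply, coordMetric_self, hw, chartMetricDeriv_eq, chartMetricDeriv_eq,
      chartMetricDeriv_eq]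
    simp [D]
  have h := Classical.epsilon_spec hex c
  rwa [← coordMetric_apply, coordMetric_self] at h

theorem eq_christoffel {x : M} {a b w : E} (h : ∀ c : E, 2 * S.form x w c =
      S.chartMetricDeriv x a b c + S.chartMetricDeriv x b a c - S.chartMetricDeriv x c a b) :
    w = S.christoffel x a b := by
  rw [← sub_eq_zero]
  refine S.eq_zero_of_forall_metric_eq_zero (x := x) (v := (w - S.christoffel x a b : E))
    fun (c : E) ↦ ?_
  change S.form x (w - S.christoffel x a b) c = 0
  have h1 := (h c).trans (S.christoffel_spec x a b c).symm
  rw [map_sub, sub_apply]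
  linarith

theorem christoffel_symm (x : M) (a b : E) : S.christoffel x a b = S.christoffel x b a := by
  refine S.eq_christoffel fun c ↦ ?_
  rw [S.christoffel_spec, S.chartMetricDeriv_symm x c a b]
  ring

theorem christoffel_smul_smul (x : M) (r : ℝ) (a b : E) :
    S.christoffel x (r • a) (r • b) = r ^ 2 • S.christoffel x a b := by
  refine (S.eq_christoffel fun c ↦ ?_).symm
  rw [map_smul, smul_apply, smul_eq_mul, mul_left_comm, S.christoffel_spec]
  simp only [chartMetricDeriv_eq, map_smul, smul_apply, smul_eq_mul]
  ring

/-- Metric compatibility at a point: in the sum of the two Koszul formulas all but the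
`c`-derivatives cancel. -/
theorem form_christoffel_add (x : M) (c a b : E) :
    S.form x (S.christoffel x c a) b + S.form x a (S.christoffel x c b) =
      S.chartMetricDeriv x c a b := by
  have h1 := S.christoffel_spec x c a b
  have h2 := S.christoffel_spec x c b a
  rw [S.form_symm] at h2
  linarith [S.chartMetricDeriv_symm x c a b, S.chartMetricDeriv_symm x a c b,
    S.chartMetricDeriv_symm x b c a]

end Christoffel

end Spacetime

theorem hasDerivAt_bilinear_comp {E : Type*} [NormedAddCommGroup E] [NormedSpace ℝ E]
    {G : E → E →L[ℝ] E →L[ℝ] ℝ} {G' : E →L[ℝ] E →L[ℝ] E →L[ℝ] ℝ} {c v w : ℝ → E}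
    {y c' v' w' : E} {t : ℝ} (hG : HasFDerivAt G G' y) (hc : HasDerivAt c c' t) (hy : y = c t)
    (hv : HasDerivAt v v' t) (hw : HasDerivAt w w' t) :
    HasDerivAt (fun s ↦ G (c s) (v s) (w s))
      (G' c' (v t) (w t) + G (c t) v' (w t) + G (c t) (v t) w') t := by
  subst hy
  have h1 : HasDerivAt (fun s ↦ G (c s)) (G' c') t := hG.comp_hasDerivAt t hc
  have h2 : HasDerivAt (fun s ↦ G (c s) (v s)) (G' c' (v t) + G (c t) v') t := h1.clm_apply hv
  exact h2.clm_apply hw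

namespace Spacetime

variable {E : Type*} [NormedAddCommGroup E] [NormedSpace ℝ E] {M : Type*}
  [TopologicalSpace M] [ChartedSpace E M] [IsManifold 𝓘(ℝ, E) ∞ M] (S : Spacetime E M)

/-! ### Covariant derivative along a curve -/

section CovariantDerivative

theorem covDeriv_eq (γ : ℝ → M) (V : ∀ t, TangentSpace 𝓘(ℝ, E) (γ t)) (t₀ : ℝ) :
    @Eq E (S.covDeriv γ V t₀) (deriv (fun t ↦ tangentCoord (γ t₀) (γ t) (V t)) t₀ +
      S.christoffel (γ t₀) (curveVelocity γ t₀) (V t₀)) := by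
  have h1 : curveComponents γ (fun t ↦ (curveVelocity γ t : TangentSpace 𝓘(ℝ, E) (γ t))) t₀ t₀ =
    (curveVelocity γ t₀ : E) := tangentCoord_self _ _
  have h2 : curveComponents γ V t₀ t₀ = (V t₀ : E) := tangentCoord_self _ _
  rw [covDeriv, h1, h2]
  exact symmL_self _ _

theorem hasDerivAt_tangentCoord {γ : ℝ → M} {V : ∀ t, TangentSpace 𝓘(ℝ, E) (γ t)} {t₀ : ℝ}
    (hV : CurveFieldDifferentiableAt γ V t₀) :
    HasDerivAt (fun t ↦ tangentCoord (γ t₀) (γ t) (V t))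
      (@HSub.hSub E E E _ (S.covDeriv γ V t₀)
        (S.christoffel (γ t₀) (curveVelocity γ t₀) (V t₀))) t₀ := by
  rw [S.covDeriv_eq γ V t₀, add_sub_cancel_right]
  exact (curveFieldDifferentiableAt_iff.1 hV).2.hasDerivAt

variable [FiniteDimensional ℝ E]

/-- The algebra of the product rule: v' and w' stand for covariant derivatives, so v' - Γ(c, v) and
w' - Γ(c, w) are derivatives of components, and the Γ terms absorb the derivative of the metric. -/
theorem fderiv_coordMetric_add (x : M) (c v w v' w' : E) :
    fderiv ℝ (S.coordMetric x) (extChartAt 𝓘(ℝ, E) x x) c v w +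
      S.coordMetric x (extChartAt 𝓘(ℝ, E) x x) (v' - S.christoffel x c v) w +
      S.coordMetric x (extChartAt 𝓘(ℝ, E) x x) v (w' - S.christoffel x c w) =
    S.form x v' w + S.form x v w' := by
  rw [coordMetric_self, coordMetric_self, ← chartMetricDeriv_eq, ← S.form_christoffel_add, map_sub,
    map_sub, sub_apply]
  ring

/-- The Levi-Civita connection is compatible with the metric. -/
theorem hasDerivAt_metric {γ : ℝ → M} {V W : ∀ t, TangentSpace 𝓘(ℝ, E) (γ t)} {t₀ : ℝ}
    (hV : CurveFieldDifferentiableAt γ V t₀) (hW : CurveFieldDifferentiableAt γ W t₀) :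
    HasDerivAt (fun t ↦ S.metric (γ t) (V t) (W t))
      (S.metric (γ t₀) (S.covDeriv γ V t₀) (W t₀) + S.metric (γ t₀) (V t₀) (S.covDeriv γ W t₀))
      t₀ := by
  have hγ := (curveFieldDifferentiableAt_iff.1 hV).1
  have h := hasDerivAt_bilinear_comp (S.hasFDerivAt_coordMetric (γ t₀))
    (hasDerivAt_extChartAt_comp hγ) rfl (S.hasDerivAt_tangentCoord hV)
    (S.hasDerivAt_tangentCoord hW)
  refine (h.congr_of_eventuallyEq ?_).congr_deriv ?_
  · filter_upwards [eventually_mem_chart (E := E) hγ.continuousAt] with t ht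
    exact S.metric_eq_coordMetric ht _ _
  · have hV0 : tangentCoord (γ t₀) (γ t₀) (V t₀) = (V t₀ : E) := tangentCoord_self _ _
    have hW0 : tangentCoord (γ t₀) (γ t₀) (W t₀) = (W t₀ : E) := tangentCoord_self _ _
    rw [hV0, hW0]
    exact S.fderiv_coordMetric_add _ _ _ _ _ _

theorem christoffel_add_smul (x : M) (a b c : E) (r : ℝ) :
    S.christoffel x a (b + r • c) = S.christoffel x a b + r • S.christoffel x a c := by
  refine (S.eq_christoffel fun d ↦ ?_).symm
  rw [map_add, map_smul, add_apply, smul_apply, smul_eq_mul, mul_add, mul_left_comm,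
    S.christoffel_spec, S.christoffel_spec]
  simp only [chartMetricDeriv_eq, map_add, map_smul, add_apply, smul_apply, smul_eq_mul]
  ring

/-- The Leibniz rule for the covariant derivative along a curve. -/
theorem covDeriv_add_smul {γ : ℝ → M} {V W : ∀ t, TangentSpace 𝓘(ℝ, E) (γ t)} {c : ℝ → ℝ}
    {c' t₀ : ℝ} (hV : CurveFieldDifferentiableAt γ V t₀) (hW : CurveFieldDifferentiableAt γ W t₀)
    (hc : HasDerivAt c c' t₀) :
    CurveFieldDifferentiableAt γ (fun t ↦ V t + c t • W t) t₀ ∧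
    S.covDeriv γ (fun t ↦ V t + c t • W t) t₀ =
      S.covDeriv γ V t₀ + c' • W t₀ + c t₀ • S.covDeriv γ W t₀ := by
  have hγ := (curveFieldDifferentiableAt_iff.1 hV).1
  have h : HasDerivAt (fun t ↦ tangentCoord (γ t₀) (γ t) (V t + c t • W t)) _ t₀ :=
    ((S.hasDerivAt_tangentCoord hV).add
      (hc.smul (S.hasDerivAt_tangentCoord hW))).congr_of_eventuallyEq (by
      filter_upwards [eventually_mem_chart (E := E) hγ.continuousAt] with t ht
      rw [tangentCoord_add ht, tangentCoord_smul ht]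
      rfl)
  refine ⟨curveFieldDifferentiableAt_iff.2 ⟨hγ, h.differentiableAt⟩, ?_⟩
  have hW0 : tangentCoord (γ t₀) (γ t₀) (W t₀) = (W t₀ : E) := tangentCoord_self _ _
  refine (S.covDeriv_eq _ _ _).trans ?_
  refine (congrArg₂ (· + ·) h.deriv (S.christoffel_add_smul _ _ _ _ _)).trans ?_
  rw [hW0]
  have key : ∀ v w x y z : E, v - x + (c t₀ • (w - y) + c' • z) + (x + c t₀ • y) =
    v + c' • z + c t₀ • w := fun v w x y z ↦ by module
  exact key _ _ _ _ _

end CovariantDerivative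

/-! ### Velocity, acceleration and affine reparametrization -/

section Curves

theorem deriv_tangentCoord_curveVelocity {γ : ℝ → M} {t : ℝ}
    (hγ : ContMDiffAt 𝓘(ℝ, ℝ) 𝓘(ℝ, E) 2 γ t) :
    deriv (fun s ↦ tangentCoord (γ t) (γ s) (curveVelocity γ s)) t =
      deriv (deriv (extChartAt 𝓘(ℝ, E) (γ t) ∘ γ)) t := by
  refine Filter.EventuallyEq.deriv_eq ?_
  filter_upwards [eventually_mem_chart (E := E) hγ.continuousAt, eventually_mdifferentiableAt hγ]
    with s hs hs'
  exact tangentCoord_curveVelocity hs hs'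

theorem covDeriv_curveVelocity {γ : ℝ → M} {t : ℝ} (hγ : ContMDiffAt 𝓘(ℝ, ℝ) 𝓘(ℝ, E) 2 γ t) :
    @Eq E (S.covDeriv γ (fun s ↦ curveVelocity γ s) t)
      (deriv (deriv (extChartAt 𝓘(ℝ, E) (γ t) ∘ γ)) t + S.christoffel (γ t)
        (deriv (extChartAt 𝓘(ℝ, E) (γ t) ∘ γ) t) (deriv (extChartAt 𝓘(ℝ, E) (γ t) ∘ γ) t)) := by
  rw [S.covDeriv_eq, deriv_tangentCoord_curveVelocity hγ,
    (hasDerivAt_extChartAt_comp (hγ.mdifferentiableAt (by simp))).deriv]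

omit [IsManifold 𝓘(ℝ, E) ∞ M] in
-- Stated in the tangent bundle because the two base points are only propositionally equal.
theorem curveVelocity_congr {γ₁ γ₂ : ℝ → M} {t : ℝ} (h : γ₁ =ᶠ[𝓝 t] γ₂) :
    @Eq (TangentBundle 𝓘(ℝ, E) M) ⟨γ₁ t, curveVelocity γ₁ t⟩ ⟨γ₂ t, curveVelocity γ₂ t⟩ := by
  have h1 := h.eq_of_nhds
  have h2 : @Eq (ℝ →L[ℝ] E) (mfderiv 𝓘(ℝ, ℝ) 𝓘(ℝ, E) γ₁ t) (mfderiv 𝓘(ℝ, ℝ) 𝓘(ℝ, E) γ₂ t) :=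
    h.mfderiv_eq
  have h3 : @Eq E (curveVelocity γ₁ t) (curveVelocity γ₂ t) :=
    congrArg (fun l : ℝ →L[ℝ] E ↦ l 1) h2
  exact TotalSpace.ext h1 (heq_of_eq h3)

theorem covDeriv_curveVelocity_congr {γ₁ γ₂ : ℝ → M} {t : ℝ} (h : γ₁ =ᶠ[𝓝 t] γ₂)
    (hγ : ContMDiffAt 𝓘(ℝ, ℝ) 𝓘(ℝ, E) 2 γ₂ t) :
    @Eq E (S.covDeriv γ₁ (fun s ↦ curveVelocity γ₁ s) t)
      (S.covDeriv γ₂ (fun s ↦ curveVelocity γ₂ s) t) := by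
  have h' : extChartAt 𝓘(ℝ, E) (γ₂ t) ∘ γ₁ =ᶠ[𝓝 t] extChartAt 𝓘(ℝ, E) (γ₂ t) ∘ γ₂ :=
    h.fun_comp _
  rw [S.covDeriv_curveVelocity hγ, S.covDeriv_curveVelocity (hγ.congr_of_eventuallyEq h),
    h.eq_of_nhds, h'.deriv_eq, h'.deriv.deriv_eq]

omit [IsManifold 𝓘(ℝ, E) ∞ M] in
theorem contMDiffAt_comp_affine {n : WithTop ℕ∞} {γ : ℝ → M} (a b t : ℝ)
    (hγ : ContMDiffAt 𝓘(ℝ, ℝ) 𝓘(ℝ, E) n γ (a + b * t)) :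
    ContMDiffAt 𝓘(ℝ, ℝ) 𝓘(ℝ, E) n (fun s ↦ γ (a + b * s)) t := by
  refine ContMDiffAt.comp (g := γ) (f := fun s : ℝ ↦ a + b * s) t hγ ?_
  rw [contMDiffAt_iff_contDiffAt]
  fun_prop

omit [IsManifold 𝓘(ℝ, E) ∞ M] in
theorem curveVelocity_comp_affine {γ : ℝ → M} (a b t : ℝ)
    (hγ : MDifferentiableAt 𝓘(ℝ, ℝ) 𝓘(ℝ, E) γ (a + b * t)) :
    @Eq E (curveVelocity (fun s ↦ γ (a + b * s)) t) (b • (curveVelocity γ (a + b * t) : E)) := by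
  have h1 : HasDerivAt (fun s : ℝ ↦ a + b * s) b t := by
    simpa using ((hasDerivAt_id t).const_mul b).const_add a
  have h2 := (hγ.hasMFDerivAt.comp (g := γ) (f := fun s : ℝ ↦ a + b * s) t
    h1.hasFDerivAt.hasMFDerivAt).mfderiv
  have h3 := congrArg (fun l : ℝ →L[ℝ] E ↦ l 1) h2
  have h4 : ∀ l : ℝ →L[ℝ] E, l ((1 : ℝ) • b : ℝ) = b • l 1 := fun l ↦ by
    rw [← map_smul, smul_eq_mul, smul_eq_mul, mul_comm]
  exact h3.trans (h4 _)

theorem covDeriv_comp_affine [FiniteDimensional ℝ E] {γ : ℝ → M} (a b t : ℝ)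
    (hγ : ContMDiffAt 𝓘(ℝ, ℝ) 𝓘(ℝ, E) 2 γ (a + b * t)) :
    @Eq E (S.covDeriv (fun s ↦ γ (a + b * s)) (fun s ↦ (curveVelocity (fun s ↦ γ (a + b * s)) s :
      TangentSpace 𝓘(ℝ, E) (γ (a + b * s)))) t)
      (b ^ 2 • (S.covDeriv γ (fun s ↦ curveVelocity γ s) (a + b * t) : E)) := by
  rw [S.covDeriv_curveVelocity hγ, S.covDeriv_curveVelocity (contMDiffAt_comp_affine a b t hγ)]
  set g := extChartAt 𝓘(ℝ, E) (γ (a + b * t)) ∘ γ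
  have h1 : ∀ (k : ℝ → E), deriv (fun s ↦ k (a + b * s)) = fun s ↦ b • deriv k (a + b * s) := by
    intro k
    ext s
    rw [deriv_comp_mul_left (f := fun s ↦ k (a + s)), deriv_comp_const_add]
  have h2 : (extChartAt 𝓘(ℝ, E) (γ (a + b * t)) ∘ fun s ↦ γ (a + b * s)) = fun s ↦ g (a + b * s) :=
    rfl
  rw [h2, h1, christoffel_smul_smul, deriv_fun_const_smul_field, h1 (deriv g)]
  have key : ∀ v w : E, b • b • v + b ^ 2 • w = b ^ 2 • (v + w) := fun v w ↦ by module
  exact key _ _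

end Curves

end Spacetime

namespace Spacetime

variable {E : Type*} [NormedAddCommGroup E] [NormedSpace ℝ E] {M : Type*}
  [TopologicalSpace M] [ChartedSpace E M] [IsManifold 𝓘(ℝ, E) ∞ M] {S : Spacetime E M}

/-! ### Geodesics, the logarithm and light rays -/

section Geodesics

theorem IsGeodesicSegment.contMDiffAt_two {γ : ℝ → M} (hγ : S.IsGeodesicSegment γ) {t : ℝ}
    (ht : t ∈ Icc (0 : ℝ) 1) : ContMDiffAt 𝓘(ℝ, ℝ) 𝓘(ℝ, E) 2 γ t :=
  (hγ t ht).1.of_le ENat.LEInfty.out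

theorem IsGeodesicSegment.mdifferentiableAt {γ : ℝ → M} (hγ : S.IsGeodesicSegment γ) {t : ℝ}
    (ht : t ∈ Icc (0 : ℝ) 1) : MDifferentiableAt 𝓘(ℝ, ℝ) 𝓘(ℝ, E) γ t :=
  (hγ t ht).1.mdifferentiableAt (by simp)

theorem metric_eq_of_mk_eq {x y : M} {v : TangentSpace 𝓘(ℝ, E) x} {w : TangentSpace 𝓘(ℝ, E) y}
    (h : (⟨x, v⟩ : TangentBundle 𝓘(ℝ, E) M) = ⟨y, w⟩) : S.metric x v v = S.metric y w w :=
  congrArg (fun z : TangentBundle 𝓘(ℝ, E) M ↦ S.metric z.1 z.2 z.2) h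

omit [IsManifold 𝓘(ℝ, E) ∞ M] in
theorem ne_zero_of_mk_eq {x y : M} {v : TangentSpace 𝓘(ℝ, E) x} {w : TangentSpace 𝓘(ℝ, E) y}
    (h : (⟨x, v⟩ : TangentBundle 𝓘(ℝ, E) M) = ⟨y, w⟩) (hw : w ≠ 0) : v ≠ 0 := by
  have h2 : @Eq E v w := congrArg (fun z : TangentBundle 𝓘(ℝ, E) M ↦ (z.2 : E)) h
  exact fun h3 ↦ hw (h2.symm.trans h3)

namespace IsConvexNormal

theorem log_eq (hS : S.IsConvexNormal) {p q : M} {v : TangentSpace 𝓘(ℝ, E) p}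
    (h : S.GeodesicReaches ⟨p, v⟩ q) : S.log p q = v := by
  have hex : ∃ v : TangentSpace 𝓘(ℝ, E) p, S.GeodesicReaches ⟨p, v⟩ q := ⟨v, h⟩
  rw [log, dif_pos hex]
  exact (hS.existsUnique_geodesic p q).unique hex.choose_spec h

theorem reaches_log (hS : S.IsConvexNormal) (p q : M) : S.GeodesicReaches ⟨p, S.log p q⟩ q := by
  obtain ⟨v, hv, -⟩ := hS.existsUnique_geodesic p q
  rwa [hS.log_eq hv]

/-- `exp` picks some endpoint by choice. A vector reaching `q` must be `log p q`, and `exp` inverts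
`log`, so every vector has at most one endpoint. -/
theorem exp_eq (hS : S.IsConvexNormal) {p q : M} {v : TangentSpace 𝓘(ℝ, E) p}
    (h : S.GeodesicReaches ⟨p, v⟩ q) : S.exp ⟨p, v⟩ = q := by
  rw [← hS.log_eq h, hS.exp_log]

end IsConvexNormal

variable [FiniteDimensional ℝ E]

theorem IsGeodesicSegment.comp_affine {γ : ℝ → M} (hγ : S.IsGeodesicSegment γ) {a b : ℝ}
    (ha : a ∈ Icc (0 : ℝ) 1) (hab : a + b ∈ Icc (0 : ℝ) 1) :
    S.IsGeodesicSegment (fun s ↦ γ (a + b * s)) := by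
  intro t ht
  have h : a + b * t ∈ Icc (0 : ℝ) 1 := by
    have := (convex_Icc (0 : ℝ) 1) ha hab (sub_nonneg.2 ht.2) ht.1 (by ring)
    convert this using 1
    simp only [smul_eq_mul]
    ring
  refine ⟨contMDiffAt_comp_affine a b t (hγ _ h).1, ?_⟩
  refine (S.covDeriv_comp_affine a b t (hγ.contMDiffAt_two h)).trans ?_
  rw [(hγ _ h).2]
  exact smul_zero (A := E) _

theorem IsGeodesicSegment.reaches {γ : ℝ → M} (hγ : S.IsGeodesicSegment γ) {a b : ℝ}
    (ha : a ∈ Icc (0 : ℝ) 1) (hab : a + b ∈ Icc (0 : ℝ) 1) :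
    S.GeodesicReaches ⟨γ a, b • curveVelocity γ a⟩ (γ (a + b)) := by
  refine ⟨_, hγ.comp_affine ha hab, ?_, by simp⟩
  have h0 : a + b * 0 = a := by ring
  refine (TotalSpace.ext (congrArg γ h0) (heq_of_eq ?_))
  refine (curveVelocity_comp_affine (E := E) a b 0
    (by rw [h0]; exact hγ.mdifferentiableAt ha)).trans ?_
  rw [h0]

/-- Compatibility and the geodesic equation make the derivative of g(γ', γ') vanish. -/
theorem IsGeodesicSegment.metric_velocity {γ : ℝ → M} (hγ : S.IsGeodesicSegment γ) {t : ℝ}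
    (ht : t ∈ Icc (0 : ℝ) 1) :
    S.metric (γ t) (curveVelocity γ t) (curveVelocity γ t) =
      S.metric (γ 0) (curveVelocity γ 0) (curveVelocity γ 0) := by
  have h : ∀ s ∈ Icc (0 : ℝ) 1, HasDerivAt
      (fun s ↦ S.metric (γ s) (curveVelocity γ s) (curveVelocity γ s)) 0 s := by
    intro s hs
    have hd := curveVelocity_differentiable (hγ.contMDiffAt_two hs)
    refine (S.hasDerivAt_metric hd hd).congr_deriv ?_
    rw [(hγ s hs).2]
    simp
  exact constant_of_has_deriv_right_zero (fun s hs ↦ (h s hs).continuousAt.continuousWithinAt)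
    (fun s hs ↦ (h s (Ico_subset_Icc_self hs)).hasDerivWithinAt) t ht

namespace IsConvexNormal

/-- If γ' vanished at `t`, the pieces from γ(t) to γ(1) and to γ(0) would both start with the zero
vector, so γ(1) = γ(0). Then γ'(0) and 0 would both reach that point from γ(0), against uniqueness.
-/
theorem velocity_ne_zero (hS : S.IsConvexNormal) {γ : ℝ → M} (hγ : S.IsGeodesicSegment γ)
    (h0 : curveVelocity (E := E) γ 0 ≠ 0) {t : ℝ} (ht : t ∈ Icc (0 : ℝ) 1) :
    curveVelocity (E := E) γ t ≠ 0 := by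
  intro h
  have h1 := hγ.reaches (a := t) (b := 1 - t) ht (by simp)
  have h2 := hγ.reaches (a := t) (b := -t) ht (by simp)
  rw [h, smul_zero, add_sub_cancel] at h1
  rw [h, smul_zero, add_neg_cancel] at h2
  have h3 : γ 1 = γ 0 := (hS.exp_eq h1).symm.trans (hS.exp_eq h2)
  have h4 := hγ.reaches (a := 0) (b := 1) (by simp) (by simp)
  have h5 := hγ.reaches (a := 0) (b := 0) (by simp) (by simp)
  rw [one_smul, zero_add, h3] at h4
  rw [zero_smul, zero_add] at h5
  exact h0 ((hS.log_eq h4).symm.trans (hS.log_eq h5))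

end IsConvexNormal

theorem continuousAt_metric_future {γ : ℝ → M} {V : ∀ t, TangentSpace 𝓘(ℝ, E) (γ t)} {t : ℝ}
    (hV : CurveFieldDifferentiableAt γ V t) :
    ContinuousAt (fun s ↦ tangentCoord (γ t) (γ s) (S.future (γ s))) t ∧
    (∀ᶠ s in 𝓝 t, ∀ w : TangentSpace 𝓘(ℝ, E) (γ s), S.metric (γ s) (S.future (γ s)) w =
      S.coordMetric (γ t) (extChartAt 𝓘(ℝ, E) (γ t) (γ s))
        (tangentCoord (γ t) (γ s) (S.future (γ s))) (tangentCoord (γ t) (γ s) w)) ∧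
    ContinuousAt (fun s ↦ S.coordMetric (γ t) (extChartAt 𝓘(ℝ, E) (γ t) (γ s))) t := by
  have hγ := (curveFieldDifferentiableAt_iff.1 hV).1
  refine ⟨?_, ?_, ?_⟩
  · have h1 : ContinuousAt (fun s ↦ (⟨γ s, S.future (γ s)⟩ : TangentBundle 𝓘(ℝ, E) M)) t :=
      ContinuousAt.comp (g := fun x : M ↦ (⟨x, S.future x⟩ : TangentBundle 𝓘(ℝ, E) M))
        S.continuous_future.continuousAt hγ.continuousAt
    exact ((FiberBundle.continuousAt_totalSpace E _).1 h1).2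
  · filter_upwards [eventually_mem_chart (E := E) hγ.continuousAt] with s hs w
    exact S.metric_eq_coordMetric hs _ _
  · exact ContinuousAt.comp (g := S.coordMetric (γ t))
      (S.hasFDerivAt_coordMetric (γ t)).continuousAt
      ((continuousAt_extChartAt (I := 𝓘(ℝ, E)) (γ t)).comp hγ.continuousAt)

theorem continuousAt_metric_future_apply {γ : ℝ → M} {V : ∀ t, TangentSpace 𝓘(ℝ, E) (γ t)} {t : ℝ}
    (hV : CurveFieldDifferentiableAt γ V t) :
    ContinuousAt (fun s ↦ S.metric (γ s) (S.future (γ s)) (V s)) t := by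
  obtain ⟨h1, h2, h3⟩ := continuousAt_metric_future (S := S) hV
  have h4 := (h3.clm_apply h1).clm_apply (curveFieldDifferentiableAt_iff.1 hV).2.continuousAt
  refine h4.congr ?_
  filter_upwards [h2] with s hs
  exact (hs _).symm

/-- A lightlike geodesic keeps its time orientation: g(future, γ') is continuous and cannot vanish,
since γ' stays lightlike and nonzero. -/
theorem IsConvexNormal.metric_future_velocity_neg (hS : S.IsConvexNormal) {γ : ℝ → M}
    (hγ : S.IsGeodesicSegment γ) (h0 : curveVelocity (E := E) γ 0 ≠ 0)
    (hnull : S.metric (γ 0) (curveVelocity γ 0) (curveVelocity γ 0) = 0)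
    (hfut : S.metric (γ 0) (S.future (γ 0)) (curveVelocity γ 0) < 0) :
    S.metric (γ 1) (S.future (γ 1)) (curveVelocity γ 1) < 0 := by
  by_contra! h
  have hc : ContinuousOn (fun s ↦ S.metric (γ s) (S.future (γ s)) (curveVelocity γ s))
      (Icc 0 1) := fun s hs ↦ (continuousAt_metric_future_apply
        (curveVelocity_differentiable (hγ.contMDiffAt_two hs))).continuousWithinAt
  obtain ⟨s, hs, hs0⟩ := intermediate_value_Icc zero_le_one hc ⟨hfut.le, h⟩
  exact S.metric_ne_zero_of_null (S.metric_future _) ((hγ.metric_velocity hs).trans hnull)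
    (hS.velocity_ne_zero hγ h0 hs) hs0

/-- A light ray from `q` to `p` is, seen from `p`, a past-pointing lightlike geodesic. -/
theorem IsConvexNormal.log_of_isLightRay (hS : S.IsConvexNormal) {p q : M}
    (h : S.IsLightRay q p) (hqp : q ≠ p) : S.log p q ≠ 0 ∧
      S.metric p (S.log p q) (S.log p q) = 0 ∧ 0 < S.metric p (S.future p) (S.log p q) := by
  obtain h | ⟨w, ⟨γ, hγ, hγ0, rfl⟩, hw, hnull, hfut⟩ := h
  · exact absurd h hqp
  obtain rfl : γ 0 = q := congrArg TotalSpace.proj hγ0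
  obtain rfl : curveVelocity γ 0 = w := by
    have h2 : @Eq E (curveVelocity γ 0) w :=
      congrArg (fun z : TangentBundle 𝓘(ℝ, E) M ↦ (z.2 : E)) hγ0
    exact h2
  -- The reversed ray s ↦ γ(1 - s), so that log_p q = -γ'(1).
  have h1 := hγ.reaches (a := 1) (b := -1) (by simp) (by simp)
  rw [add_neg_cancel] at h1
  rw [hS.log_eq h1]
  have h2 := hS.metric_future_velocity_neg hγ hw hnull hfut
  have h3 := hγ.metric_velocity (t := 1) (by simp)
  refine ⟨?_, ?_, ?_⟩
  · simpa using hS.velocity_ne_zero hγ hw (t := 1) (by simp)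
  · rw [map_smul, map_smul, smul_apply, h3, hnull]
    simp
  · rw [map_smul]
    simpa using h2

theorem IsConvexNormal.log_self (hS : S.IsConvexNormal) (p : M) : S.log p p = 0 := by
  obtain ⟨γ, hγ, h0, -⟩ := hS.reaches_log p p
  obtain rfl : γ 0 = p := congrArg TotalSpace.proj h0
  have h5 := hγ.reaches (a := 0) (b := 0) (by simp) (by simp)
  rw [zero_smul, zero_add] at h5
  exact hS.log_eq h5

end Geodesics

end Spacetime

/-! ### Two-parameter maps -/

section Variation

variable {E : Type*} [NormedAddCommGroup E] [NormedSpace ℝ E] {M : Type*}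
  [TopologicalSpace M] [ChartedSpace E M] [IsManifold 𝓘(ℝ, E) ∞ M]

/-- The longitudinal velocity field of a two-parameter map. -/
def variationFst (α : ℝ × ℝ → M) (r t : ℝ) : TangentSpace 𝓘(ℝ, E) (α (r, t)) :=
  curveVelocity (fun s ↦ α (s, t)) r

/-- The transversal velocity field of a two-parameter map. -/
def variationSnd (α : ℝ × ℝ → M) (r t : ℝ) : TangentSpace 𝓘(ℝ, E) (α (r, t)) :=
  curveVelocity (fun s ↦ α (r, s)) t

omit [IsManifold 𝓘(ℝ, E) ∞ M] in
theorem contMDiffAt_comp_mk_left {n : WithTop ℕ∞} {α : ℝ × ℝ → M} {r t : ℝ}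
    (hα : ContMDiffAt 𝓘(ℝ, ℝ × ℝ) 𝓘(ℝ, E) n α (r, t)) :
    ContMDiffAt 𝓘(ℝ, ℝ) 𝓘(ℝ, E) n (fun s ↦ α (s, t)) r := by
  refine ContMDiffAt.comp (g := α) (f := fun s : ℝ ↦ (s, t)) r hα ?_
  rw [contMDiffAt_iff_contDiffAt]
  fun_prop

omit [IsManifold 𝓘(ℝ, E) ∞ M] in
theorem contMDiffAt_comp_mk_right {n : WithTop ℕ∞} {α : ℝ × ℝ → M} {r t : ℝ}
    (hα : ContMDiffAt 𝓘(ℝ, ℝ × ℝ) 𝓘(ℝ, E) n α (r, t)) :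
    ContMDiffAt 𝓘(ℝ, ℝ) 𝓘(ℝ, E) n (fun s ↦ α (r, s)) t := by
  refine ContMDiffAt.comp (g := α) (f := fun s : ℝ ↦ (r, s)) t hα ?_
  rw [contMDiffAt_iff_contDiffAt]
  fun_prop

theorem eventually_tangentCoord_variation {α : ℝ × ℝ → M} {r t : ℝ}
    (hα : ContMDiffAt 𝓘(ℝ, ℝ × ℝ) 𝓘(ℝ, E) 2 α (r, t)) : ∀ᶠ z : ℝ × ℝ in 𝓝 (r, t),
      tangentCoord (α (r, t)) (α z) (variationFst α z.1 z.2) =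
        fderiv ℝ (extChartAt 𝓘(ℝ, E) (α (r, t)) ∘ α) z (1, 0) ∧
      tangentCoord (α (r, t)) (α z) (variationSnd α z.1 z.2) =
        fderiv ℝ (extChartAt 𝓘(ℝ, E) (α (r, t)) ∘ α) z (0, 1) := by
  have h1 := (contMDiffAt_iff_contMDiffAt_nhds (I := 𝓘(ℝ, ℝ × ℝ)) (I' := 𝓘(ℝ, E)) (n := 1)
    (by simp)).1 (hα.of_le (by norm_num))
  have h2 : ∀ᶠ z in 𝓝 (r, t), α z ∈ (chartAt E (α (r, t))).source :=
    hα.continuousAt.eventually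
      ((chartAt E (α (r, t))).open_source.mem_nhds (mem_chart_source E (α (r, t))))
  filter_upwards [h1, h2] with z hz hz'
  have hd : DifferentiableAt ℝ (extChartAt 𝓘(ℝ, E) (α (r, t)) ∘ α) z := by
    rw [← mdifferentiableAt_iff_differentiableAt]
    exact (mdifferentiableAt_extChartAt hz').comp z (hz.mdifferentiableAt (by simp))
  constructor
  · refine (tangentCoord_curveVelocity (γ := fun s ↦ α (s, z.2)) hz'
      ((contMDiffAt_comp_mk_left hz).mdifferentiableAt (by simp))).trans ?_
    have h3 : HasDerivAt (fun s : ℝ ↦ (s, z.2)) (1, 0) z.1 :=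
      (hasDerivAt_id z.1).prodMk (hasDerivAt_const z.1 z.2)
    exact (hd.hasFDerivAt.comp_hasDerivAt_of_eq z.1 h3 rfl).deriv
  · refine (tangentCoord_curveVelocity (γ := fun s ↦ α (z.1, s)) hz'
      ((contMDiffAt_comp_mk_right hz).mdifferentiableAt (by simp))).trans ?_
    have h3 : HasDerivAt (fun s : ℝ ↦ (z.1, s)) (0, 1) z.2 :=
      (hasDerivAt_const z.2 z.1).prodMk (hasDerivAt_id z.2)
    exact (hd.hasFDerivAt.comp_hasDerivAt_of_eq z.2 h3 rfl).deriv

/-- Both derivatives are the same mixed second partial of the coordinate expression, by symmetry of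
second derivatives. -/
theorem hasDerivAt_variation {α : ℝ × ℝ → M} {r t : ℝ}
    (hα : ContMDiffAt 𝓘(ℝ, ℝ × ℝ) 𝓘(ℝ, E) 2 α (r, t)) :
    HasDerivAt (fun s ↦ tangentCoord (α (r, t)) (α (r, s)) (variationFst α r s))
      (fderiv ℝ (fderiv ℝ (extChartAt 𝓘(ℝ, E) (α (r, t)) ∘ α)) (r, t) (0, 1) (1, 0)) t ∧
    HasDerivAt (fun s ↦ tangentCoord (α (r, t)) (α (s, t)) (variationSnd α s t))
      (fderiv ℝ (fderiv ℝ (extChartAt 𝓘(ℝ, E) (α (r, t)) ∘ α)) (r, t) (0, 1) (1, 0)) r := by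
  have hA := contDiffAt_extChartAt_comp hα
  have hs : IsSymmSndFDerivAt ℝ (extChartAt 𝓘(ℝ, E) (α (r, t)) ∘ α) (r, t) :=
    hA.isSymmSndFDerivAt (by simp)
  have hd := ((hA.fderiv_right (m := 1) (by norm_num)).differentiableAt (by simp)).hasFDerivAt
  have h := eventually_tangentCoord_variation hα
  have h1 : HasDerivAt (fun s : ℝ ↦ (r, s)) (0, 1) t :=
    (hasDerivAt_const t r).prodMk (hasDerivAt_id t)
  have h2 : HasDerivAt (fun s : ℝ ↦ (s, t)) (1, 0) r :=
    (hasDerivAt_id r).prodMk (hasDerivAt_const r t)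
  constructor
  · have h3 := (hd.comp_hasDerivAt_of_eq t h1 rfl).clm_apply (hasDerivAt_const t ((1, 0) : ℝ × ℝ))
    refine (h3.congr_of_eventuallyEq ?_).congr_deriv (by simp)
    filter_upwards [h1.continuousAt.eventually h] with s hs using hs.1
  · have h3 := (hd.comp_hasDerivAt_of_eq r h2 rfl).clm_apply (hasDerivAt_const r ((0, 1) : ℝ × ℝ))
    refine (h3.congr_of_eventuallyEq ?_).congr_deriv (by simpa using hs.eq _ _)
    filter_upwards [h2.continuousAt.eventually h] with s hs using hs.2

theorem curveFieldDifferentiableAt_variation {α : ℝ × ℝ → M} {r t : ℝ}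
    (hα : ContMDiffAt 𝓘(ℝ, ℝ × ℝ) 𝓘(ℝ, E) 2 α (r, t)) :
    CurveFieldDifferentiableAt (fun s ↦ α (r, s)) (fun s ↦ variationFst (E := E) α r s) t ∧
    CurveFieldDifferentiableAt (fun s ↦ α (s, t)) (fun s ↦ variationSnd (E := E) α s t) r :=
  ⟨curveFieldDifferentiableAt_iff.2
    ⟨(contMDiffAt_comp_mk_right hα).mdifferentiableAt (by simp),
      (hasDerivAt_variation hα).1.differentiableAt⟩,
   curveFieldDifferentiableAt_iff.2
    ⟨(contMDiffAt_comp_mk_left hα).mdifferentiableAt (by simp),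
      (hasDerivAt_variation hα).2.differentiableAt⟩⟩

variable [FiniteDimensional ℝ E]

/-- The Levi-Civita connection is torsion-free. -/
theorem Spacetime.covDeriv_variation (S : Spacetime E M) {α : ℝ × ℝ → M} {r t : ℝ}
    (hα : ContMDiffAt 𝓘(ℝ, ℝ × ℝ) 𝓘(ℝ, E) 2 α (r, t)) :
    S.covDeriv (fun s ↦ α (s, t)) (fun s ↦ variationSnd α s t) r =
      S.covDeriv (fun s ↦ α (r, s)) (fun s ↦ variationFst α r s) t := by
  refine (S.covDeriv_eq _ _ _).trans (Eq.trans ?_ (S.covDeriv_eq _ _ _).symm)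
  rw [(hasDerivAt_variation hα).1.deriv, (hasDerivAt_variation hα).2.deriv]
  exact congrArg _ (S.christoffel_symm _ _ _)

/-- The first variation formula, in infinitesimal form. -/
theorem Spacetime.hasDerivAt_metric_variation (S : Spacetime E M) {α : ℝ × ℝ → M} {r t h' : ℝ}
    (hα : ContMDiffAt 𝓘(ℝ, ℝ × ℝ) 𝓘(ℝ, E) 2 α (r, t))
    (hgeo : S.covDeriv (fun s ↦ α (s, t)) (fun s ↦ variationFst α s t) r = 0)
    (hh : HasDerivAt (fun s ↦ S.metric (α (r, s)) (variationFst α r s) (variationFst α r s)) h' t) :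
    HasDerivAt (fun s ↦ S.metric (α (s, t)) (variationFst α s t) (variationSnd α s t))
      (h' / 2) r := by
  have hd := curveFieldDifferentiableAt_variation hα
  have h1 := (S.hasDerivAt_metric hd.1 hd.1).unique hh
  have hv : CurveFieldDifferentiableAt (fun s ↦ α (s, t))
      (fun s ↦ variationFst (E := E) α s t) r :=
    curveVelocity_differentiable (contMDiffAt_comp_mk_left hα)
  refine (S.hasDerivAt_metric hv hd.2).congr_deriv ?_
  -- ∂_r g(∂_r, ∂_t) = g(∂_r, ∇_r ∂_t) = g(∂_r, ∇_t ∂_r) = ½ ∂_t g(∂_r, ∂_r).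
  rw [hgeo, S.covDeriv_variation hα, ← h1, map_zero, zero_apply, zero_add]
  have h2 := S.metric_symm (α (r, t)) (S.covDeriv (fun s ↦ α (r, s))
    (fun s ↦ variationFst α r s) t) (variationFst α r t)
  linarith

end Variation

/-! ### The exponential map and the Gauss lemma -/

namespace Spacetime

variable {E : Type*} [NormedAddCommGroup E] [NormedSpace ℝ E] {M : Type*}
  [TopologicalSpace M] [ChartedSpace E M] [IsManifold 𝓘(ℝ, E) ∞ M] {S : Spacetime E M}

theorem contMDiff_tangentSpace_mk (p : M) : ContMDiff 𝓘(ℝ, E) 𝓘(ℝ, E).tangent ∞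
    (fun v : E ↦ (⟨p, v⟩ : TangentBundle 𝓘(ℝ, E) M)) := by
  intro v
  refine contMDiffAt_totalSpace.2 ⟨contMDiffAt_const, ?_⟩
  have h : (fun v : E ↦ tangentCoord p p v) = id := funext fun v ↦ tangentCoord_self p v
  change ContMDiffAt _ _ _ (fun v : E ↦ tangentCoord p p v) v
  rw [h]
  exact contMDiffAt_id

theorem form_smul_smul (S : Spacetime E M) (x : M) (r : ℝ) (v : E) :
    S.form x (r • v) (r • v) = r ^ 2 * S.form x v v := by
  simp only [map_smul, smul_apply, smul_eq_mul]
  ring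

variable [FiniteDimensional ℝ E]

namespace IsConvexNormal

theorem smul_mem_expDomain {p : M} {v : E}
    (hv : (⟨p, v⟩ : TangentBundle 𝓘(ℝ, E) M) ∈ S.expDomain) {r : ℝ} (hr : r ∈ Icc (0 : ℝ) 1) :
    (⟨p, r • v⟩ : TangentBundle 𝓘(ℝ, E) M) ∈ S.expDomain := by
  obtain ⟨q, γ, hγ, h0, -⟩ := hv
  obtain rfl : γ 0 = p := congrArg TotalSpace.proj h0
  obtain rfl : curveVelocity γ 0 = v :=
    congrArg (fun z : TangentBundle 𝓘(ℝ, E) M ↦ (z.2 : E)) h0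
  exact ⟨_, hγ.reaches (a := 0) (b := r) (by simp) (by simpa using hr)⟩

theorem exp_smul (hS : S.IsConvexNormal) {γ : ℝ → M} (hγ : S.IsGeodesicSegment γ) {r : ℝ}
    (hr : r ∈ Icc (0 : ℝ) 1) : S.exp ⟨γ 0, r • curveVelocity γ 0⟩ = γ r := by
  have h := hγ.reaches (a := 0) (b := r) (by simp) (by simpa using hr)
  rw [zero_add] at h
  exact hS.exp_eq h

/-- The curves `r ↦ exp (r v)` are geodesics of constant speed. -/
theorem exp_smul_geodesic (hS : S.IsConvexNormal) {p : M} {v : E}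
    (hv : (⟨p, v⟩ : TangentBundle 𝓘(ℝ, E) M) ∈ S.expDomain) {c : ℝ → M}
    (hc : ∀ r, c r = S.exp ⟨p, r • v⟩) {r : ℝ} (hr : r ∈ Ioc (0 : ℝ) 1) :
    S.covDeriv c (fun s ↦ curveVelocity c s) r = 0 ∧
      S.metric (c r) (curveVelocity c r) (curveVelocity c r) = S.form p v v ∧
      (v ≠ 0 → curveVelocity (E := E) c r ≠ 0) := by
  have hcont : Continuous fun s : ℝ ↦ (⟨p, s • v⟩ : TangentBundle 𝓘(ℝ, E) M) :=
    (contMDiff_tangentSpace_mk (E := E) p).continuous.comp (continuous_id.smul continuous_const)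
  have hev : ∀ᶠ s in 𝓝 (1 : ℝ), (⟨p, s • v⟩ : TangentBundle 𝓘(ℝ, E) M) ∈ S.expDomain :=
    hcont.continuousAt.eventually (hS.isOpen_expDomain.mem_nhds
      (smul_mem_expDomain hv (by simp)))
  -- Derivatives at r = 1 need a two-sided neighborhood, while the geodesic of `v` is controlled
  -- only on [0, 1]. As the domain is open, δ • v still lies in it for some δ > 1, and `c` is the
  -- geodesic of δ • v run at speed δ⁻¹.
  obtain ⟨δ, hδ, hδ1⟩ : ∃ δ : ℝ, (⟨p, δ • v⟩ : TangentBundle 𝓘(ℝ, E) M) ∈ S.expDomain ∧ 1 < δ :=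
    ((hev.filter_mono nhdsWithin_le_nhds).and (self_mem_nhdsWithin (s := Ioi 1))).exists
  obtain ⟨q, γ, hγ, h0, -⟩ := hδ
  have hδ0 : 0 < δ := by linarith
  obtain rfl : γ 0 = p := congrArg TotalSpace.proj h0
  have hvel : @Eq E (curveVelocity γ 0) (δ • v) :=
    congrArg (fun z : TangentBundle 𝓘(ℝ, E) M ↦ (z.2 : E)) h0
  have hmem : ∀ s ∈ Ioo 0 δ, δ⁻¹ * s ∈ Icc (0 : ℝ) 1 := fun s hs ↦
    ⟨by have := hs.1; positivity, by rw [inv_mul_le_iff₀ hδ0]; linarith [hs.2]⟩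
  have hrδ : r ∈ Ioo 0 δ := ⟨hr.1, hr.2.trans_lt hδ1⟩
  have heq : c =ᶠ[𝓝 r] fun s ↦ γ (0 + δ⁻¹ * s) := by
    filter_upwards [isOpen_Ioo.mem_nhds hrδ] with s hs
    rw [hc, zero_add, ← hS.exp_smul hγ (hmem s hs)]
    congr 1
    refine TotalSpace.ext rfl (heq_of_eq ?_)
    have h1 : s • v = (δ⁻¹ * s) • δ • v := by
      rw [smul_smul]
      congr 1
      field_simp
    exact h1.trans (congrArg (fun w : E ↦ (δ⁻¹ * s) • w) hvel.symm)
  have hrm : 0 + δ⁻¹ * r ∈ Icc (0 : ℝ) 1 := by rw [zero_add]; exact hmem r hrδ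
  have hsm := hγ.contMDiffAt_two hrm
  have hsm' := contMDiffAt_comp_affine 0 δ⁻¹ r hsm
  have hcv := curveVelocity_congr (E := E) heq
  have haff := curveVelocity_comp_affine (E := E) 0 δ⁻¹ r (hγ.mdifferentiableAt hrm)
  refine ⟨?_, ?_, fun hv0 ↦ ?_⟩
  · refine (S.covDeriv_curveVelocity_congr heq hsm').trans ?_
    refine (S.covDeriv_comp_affine 0 δ⁻¹ r hsm).trans ?_
    rw [(hγ _ hrm).2]
    exact smul_zero (A := E) _
  · have h1 := hγ.metric_velocity hrm
    rw [metric_eq_of_mk_eq hcv]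
    simp only [S.metric_eq_form] at h1 ⊢
    rw [hvel, form_smul_smul] at h1
    rw [haff]
    refine (S.form_smul_smul _ _ _).trans ?_
    rw [h1]
    field_simp
  · refine ne_zero_of_mk_eq hcv ?_
    have hγ0 : curveVelocity (E := E) γ 0 ≠ 0 := fun h ↦
      smul_ne_zero hδ0.ne' hv0 (hvel.symm.trans h)
    exact fun h ↦ smul_ne_zero (M := E) (inv_ne_zero hδ0.ne') (hS.velocity_ne_zero hγ hγ0 hrm)
      (haff.symm.trans h)

/-- The Gauss lemma. -/
theorem gauss (hS : S.IsConvexNormal) {p : M} {L : ℝ → E} {L' : E} {t₀ : ℝ} {α : ℝ × ℝ → M}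
    (hdom : ∀ t, (⟨p, L t⟩ : TangentBundle 𝓘(ℝ, E) M) ∈ S.expDomain)
    (hL : ContDiffAt ℝ 2 L t₀) (hL' : HasDerivAt L L' t₀)
    (hα : ∀ z, α z = S.exp ⟨p, z.1 • L z.2⟩) :
    S.metric (α (1, t₀)) (variationFst α 1 t₀) (variationSnd α 1 t₀) = S.form p (L t₀) L' := by
  have hsm : ∀ r ∈ Icc (0 : ℝ) 1, ContMDiffAt 𝓘(ℝ, ℝ × ℝ) 𝓘(ℝ, E) 2 α (r, t₀) := by
    intro r hr
    have h1 : ContMDiffAt 𝓘(ℝ, E).tangent 𝓘(ℝ, E) 2 S.exp ⟨p, r • L t₀⟩ :=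
      ((hS.contMDiffOn_exp).contMDiffAt (hS.isOpen_expDomain.mem_nhds
        (smul_mem_expDomain (hdom t₀) hr))).of_le ENat.LEInfty.out
    have h2 : ContMDiffAt 𝓘(ℝ, ℝ × ℝ) 𝓘(ℝ, E) 2 (fun z : ℝ × ℝ ↦ z.1 • L z.2) (r, t₀) := by
      rw [contMDiffAt_iff_contDiffAt]
      exact contDiffAt_fst.smul (hL.comp (r, t₀) contDiffAt_snd)
    have h3 : ContMDiffAt 𝓘(ℝ, E) 𝓘(ℝ, E).tangent 2
        (fun v : E ↦ (⟨p, v⟩ : TangentBundle 𝓘(ℝ, E) M)) (r • L t₀) :=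
      (contMDiff_tangentSpace_mk p).contMDiffAt.of_le ENat.LEInfty.out
    have h4 := h1.comp (r, t₀) (h3.comp (r, t₀) h2)
    exact h4.congr_of_eventuallyEq (Eventually.of_forall hα)
  have hh : HasDerivAt (fun t ↦ S.form p (L t) (L t)) (2 * S.form p (L t₀) L') t₀ := by
    refine (((hasDerivAt_const t₀ (S.form p)).clm_apply hL').clm_apply hL').congr_deriv ?_
    rw [add_apply, S.form_symm p L', zero_apply, zero_apply]
    ring
  have hgeo : ∀ t, ∀ r ∈ Ioc (0 : ℝ) 1,
      S.covDeriv (fun s ↦ α (s, t)) (fun s ↦ variationFst α s t) r = 0 ∧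
      S.metric (α (r, t)) (variationFst α r t) (variationFst α r t) = S.form p (L t) (L t) :=
    fun t r hr ↦
      have h := hS.exp_smul_geodesic (hdom t) (c := fun s ↦ α (s, t)) (fun s ↦ hα _) hr
      ⟨h.1, h.2.1⟩
  -- The rays have squared speed g(L, L), independent of r, so g(∂_r, ∂_t) has the constant
  -- r-derivative g(L, L'). It vanishes at r = 0, where all rays start at `p`, so its value at r = 1
  -- is g(L, L').
  have hP : ∀ r ∈ Ioo (0 : ℝ) 1, HasDerivAt
      (fun s ↦ S.metric (α (s, t₀)) (variationFst α s t₀) (variationSnd α s t₀))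
      (2 * S.form p (L t₀) L' / 2) r := fun r hr ↦
    S.hasDerivAt_metric_variation (hsm r (Ioo_subset_Icc_self hr))
      (hgeo t₀ r (Ioo_subset_Ioc_self hr)).1
      (hh.congr_of_eventuallyEq (Eventually.of_forall fun t ↦
        (hgeo t r (Ioo_subset_Ioc_self hr)).2))
  have hcont : ContinuousOn
      (fun s ↦ S.metric (α (s, t₀)) (variationFst α s t₀) (variationSnd α s t₀)) (Icc 0 1) :=
    fun r hr ↦ (S.hasDerivAt_metric (curveVelocity_differentiable
        (contMDiffAt_comp_mk_left (hsm r hr)))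
      (curveFieldDifferentiableAt_variation (hsm r hr)).2).continuousAt.continuousWithinAt
  obtain ⟨s, -, hs⟩ := exists_hasDerivAt_eq_slope _ _ zero_lt_one hcont hP
  have h0 : variationSnd (E := E) α 0 t₀ = 0 := by
    have h1 : (fun t ↦ α (0, t)) = fun _ ↦ α (0, t₀) := by
      ext t
      simp only [hα, zero_smul]
    rw [variationSnd, curveVelocity, h1, mfderiv_const]
    rfl
  rw [h0, map_zero] at hs
  linarith

end IsConvexNormal

end Spacetime

theorem tendsto_clm_apply {X E F : Type*} [NormedAddCommGroup E] [NormedSpace ℝ E]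
    [NormedAddCommGroup F] [NormedSpace ℝ F] {l : Filter X} {f : X → E →L[ℝ] F} {g : X → E}
    {a : E →L[ℝ] F} {b : E} (hf : Tendsto f l (𝓝 a)) (hg : Tendsto g l (𝓝 b)) :
    Tendsto (fun x ↦ f x (g x)) l (𝓝 (a b)) :=
  (isBoundedBilinearMap_apply.continuous.tendsto (a, b)).comp (hf.prodMk_nhds hg)

namespace Spacetime

variable {E : Type*} [NormedAddCommGroup E] [NormedSpace ℝ E] {M : Type*}
  [TopologicalSpace M] [ChartedSpace E M] [IsManifold 𝓘(ℝ, E) ∞ M] (S : Spacetime E M)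

/-! ### The differential of the logarithm -/

section LogDerivative

/-- The components of `log x y` in the preferred chart at `p`. -/
def logCoord (p : M) (z : M × M) : E := tangentCoord p z.1 (S.log z.1 z.2)

/-- The differential of `logCoord p` at `(p, q)`. -/
def logDeriv (p q : M) : E × E →L[ℝ] E :=
  mfderiv (𝓘(ℝ, E).prod 𝓘(ℝ, E)) 𝓘(ℝ, E) (S.logCoord p) (p, q)

variable {S}

theorem IsConvexNormal.contMDiffAt_logCoord (hS : S.IsConvexNormal) (p q : M) :
    ContMDiffAt (𝓘(ℝ, E).prod 𝓘(ℝ, E)) 𝓘(ℝ, E) ∞ (S.logCoord p) (p, q) :=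
  (contMDiffAt_totalSpace.1 (hS.contMDiff_log (p, q))).2

theorem IsConvexNormal.hasDerivAt_logCoord (hS : S.IsConvexNormal) {γ δ : ℝ → M} {t : ℝ}
    (hγ : MDifferentiableAt 𝓘(ℝ, ℝ) 𝓘(ℝ, E) γ t) (hδ : MDifferentiableAt 𝓘(ℝ, ℝ) 𝓘(ℝ, E) δ t) :
    HasDerivAt (fun s ↦ S.logCoord (γ t) (γ s, δ s))
      (S.logDeriv (γ t) (δ t) (curveVelocity γ t, curveVelocity δ t)) t := by
  have h1 := ((hS.contMDiffAt_logCoord (γ t) (δ t)).mdifferentiableAt (by simp)).hasMFDerivAt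
  have h2 := h1.comp (g := S.logCoord (γ t)) (f := fun s ↦ (γ s, δ s)) t
    (hγ.hasMFDerivAt.prodMk hδ.hasMFDerivAt)
  have h3 : fderiv ℝ (fun s ↦ S.logCoord (γ t) (γ s, δ s)) t 1 =
      S.logDeriv (γ t) (δ t) (curveVelocity γ t, curveVelocity δ t) := by
    rw [← mfderiv_eq_fderiv]
    exact congrArg (fun l : ℝ →L[ℝ] E ↦ l 1) h2.mfderiv
  exact h2.mdifferentiableAt.differentiableAt.hasDerivAt.congr_deriv
    (fderiv_apply_one_eq_deriv.symm.trans h3)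

/-- The chain rule for the smooth map log; the result isolates `deriv f τ` as the one quantity still
to be determined. -/
theorem IsConvexNormal.relPositionField_differentiable (hS : S.IsConvexNormal) {β β' : ℝ → M}
    {f : ℝ → ℝ} {τ : ℝ} (hβ : MDifferentiableAt 𝓘(ℝ, ℝ) 𝓘(ℝ, E) β τ)
    (hβ' : MDifferentiableAt 𝓘(ℝ, ℝ) 𝓘(ℝ, E) β' (f τ)) (hf : DifferentiableAt ℝ f τ) :
    CurveFieldDifferentiableAt β (S.relPositionField β β' f) τ ∧
      @Eq E (S.covDeriv β (S.relPositionField β β' f) τ)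
        (S.logDeriv (β τ) (β' (f τ)) (curveVelocity β τ, 0) +
          deriv f τ • S.logDeriv (β τ) (β' (f τ)) (0, curveVelocity β' (f τ)) +
          S.christoffel (β τ) (curveVelocity β τ) (S.log (β τ) (β' (f τ)))) := by
  have h1 : HasMFDerivAt 𝓘(ℝ, ℝ) 𝓘(ℝ, E) (fun t ↦ β' (f t)) τ _ :=
    hβ'.hasMFDerivAt.comp (g := β') τ hf.hasDerivAt.hasFDerivAt.hasMFDerivAt
  have h2 : @Eq E (curveVelocity (fun t ↦ β' (f t)) τ)
      (deriv f τ • (curveVelocity β' (f τ) : E)) := by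
    have h3 : ∀ l : ℝ →L[ℝ] E, l ((1 : ℝ) • deriv f τ : ℝ) = deriv f τ • l 1 := fun l ↦ by
      rw [← map_smul, smul_eq_mul, smul_eq_mul, mul_comm]
    exact (congrArg (fun l : ℝ →L[ℝ] E ↦ l 1) h1.mfderiv).trans (h3 _)
  have h4 := hS.hasDerivAt_logCoord hβ h1.mdifferentiableAt
  rw [h2] at h4
  have h5 : HasDerivAt (fun t ↦ tangentCoord (β τ) (β t) (S.relPositionField β β' f t)) _ τ := h4
  refine ⟨curveFieldDifferentiableAt_iff.2 ⟨hβ, h5.differentiableAt⟩, ?_⟩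
  rw [S.covDeriv_eq, h5.deriv]
  have h6 : ∀ (l : E × E →L[ℝ] E) (c : ℝ) (v w : E), l (v, c • w) = l (v, 0) + c • l (0, w) := by
    intro l c v w
    rw [← map_smul, ← map_add]
    simp
  exact congrArg (· + S.christoffel (β τ) (curveVelocity β τ) (S.log (β τ) (β' (f τ))))
    (h6 _ _ _ _)

theorem IsConvexNormal.hasDerivAt_log (hS : S.IsConvexNormal) (p : M) {δ : ℝ → M} {t : ℝ}
    (hδ : MDifferentiableAt 𝓘(ℝ, ℝ) 𝓘(ℝ, E) δ t) :
    HasDerivAt (fun s ↦ (S.log p (δ s) : E)) (S.logDeriv p (δ t) (0, curveVelocity δ t)) t := by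
  have h := hS.hasDerivAt_logCoord (γ := fun _ ↦ p) mdifferentiableAt_const hδ
  have h0 : @Eq E (curveVelocity (fun _ : ℝ ↦ p) t) 0 := by
    rw [curveVelocity, mfderiv_const]
    rfl
  rw [h0] at h
  have h1 : (fun s ↦ S.logCoord p (p, δ s)) = fun s ↦ (S.log p (δ s) : E) :=
    funext fun s ↦ tangentCoord_self _ _
  rwa [h1] at h

variable [FiniteDimensional ℝ E]

/-- By the Gauss lemma the pairing equals g(w, δ'), with w the end velocity of the geodesic from `p`
to δ(t). As w is lightlike and nonzero and δ' is timelike, they are not orthogonal. -/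
theorem IsConvexNormal.form_logDeriv_ne_zero (hS : S.IsConvexNormal) {p : M} {δ : ℝ → M} {t : ℝ}
    (hδ : ContMDiffAt 𝓘(ℝ, ℝ) 𝓘(ℝ, E) ∞ δ t)
    (htime : S.metric (δ t) (curveVelocity δ t) (curveVelocity δ t) < 0)
    (hnull : S.metric p (S.log p (δ t)) (S.log p (δ t)) = 0) (hne : S.log p (δ t) ≠ 0) :
    S.form p (S.logDeriv p (δ t) (0, curveVelocity δ t)) (S.log p (δ t)) ≠ 0 := by
  set L : ℝ → E := fun s ↦ S.log p (δ s)
  set α : ℝ × ℝ → M := fun z ↦ S.exp ⟨p, z.1 • L z.2⟩ with hα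
  have hdom : ∀ s, (⟨p, L s⟩ : TangentBundle 𝓘(ℝ, E) M) ∈ S.expDomain :=
    fun s ↦ ⟨_, hS.reaches_log p (δ s)⟩
  have hL : ContDiffAt ℝ 2 L t := by
    rw [← contMDiffAt_iff_contDiffAt]
    have h1 : ContMDiffAt 𝓘(ℝ, ℝ) 𝓘(ℝ, E) ∞ (fun s ↦ S.logCoord p (p, δ s)) t :=
      (hS.contMDiffAt_logCoord p (δ t)).comp (g := S.logCoord p) (f := fun s ↦ (p, δ s)) t
        (contMDiffAt_const.prodMk hδ)
    have h2 : (fun s ↦ S.logCoord p (p, δ s)) = L := funext fun s ↦ tangentCoord_self _ _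
    rw [h2] at h1
    exact h1.of_le ENat.LEInfty.out
  have hgauss := hS.gauss hdom hL (hS.hasDerivAt_log p (hδ.mdifferentiableAt (by simp)))
    (α := α) (fun _ ↦ rfl)
  have hgeo := hS.exp_smul_geodesic (hdom t) (c := fun s ↦ α (s, t)) (fun _ ↦ rfl)
    (r := 1) (by simp)
  have hend : (fun s ↦ α (1, s)) = δ := by
    ext s
    have h1 : (1 : ℝ) • L s = L s := one_smul _ _
    simp only [hα, h1]
    exact hS.exp_log p (δ s)
  have htime' : S.metric (α (1, t)) (variationSnd α 1 t) (variationSnd α 1 t) < 0 :=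
    (metric_eq_of_mk_eq (curveVelocity_congr (EventuallyEq.of_eq hend))).trans_lt htime
  exact fun h ↦ S.metric_ne_zero_of_null htime' (hgeo.2.1.trans hnull) (hgeo.2.2 hne)
    ((S.metric_symm _ _ _).trans (hgauss.trans ((S.form_symm _ _ _).trans h)))

end LogDerivative

/-! ### The vertex of the light cone -/

section Vertex

variable {S} [FiniteDimensional ℝ E]

theorem christoffel_zero_right (x : M) (a : E) : S.christoffel x a 0 = 0 := by
  have h := S.christoffel_add_smul x a 0 0 1
  simpa using h

/-- A vector field along a curve that is lightlike and past-pointing, or zero, has a zero covariant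
derivative where it vanishes. -/
theorem covDeriv_eq_zero_of_null {γ : ℝ → M} {V : ∀ t, TangentSpace 𝓘(ℝ, E) (γ t)} {t : ℝ}
    (hV : CurveFieldDifferentiableAt γ V t) (h0 : V t = 0)
    (hnull : ∀ᶠ s in 𝓝 t, S.metric (γ s) (V s) (V s) = 0)
    (hpast : ∀ᶠ s in 𝓝 t, 0 ≤ S.metric (γ s) (S.future (γ s)) (V s)) :
    S.covDeriv γ V t = 0 := by
  obtain ⟨hγ, hd⟩ := curveFieldDifferentiableAt_iff.1 hV
  obtain ⟨hfut, hfutV, hG⟩ := continuousAt_metric_future (S := S) hV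
  set L : ℝ → E := fun s ↦ tangentCoord (γ t) (γ s) (V s)
  set X := deriv L t
  have hL0 : L t = 0 := (tangentCoord_self (γ t) (V t)).trans h0
  have hcov : @Eq E (S.covDeriv γ V t) X := by
    rw [S.covDeriv_eq, h0]
    exact (congrArg _ (christoffel_zero_right (S := S) _ _)).trans (add_zero _)
  -- Since `L` vanishes at `t`, its difference quotients are multiples of the lightlike vectors `L
  -- s`, so their limit `X` is lightlike.
  have hσ : Tendsto (fun s ↦ (s - t)⁻¹ • L s) (𝓝[≠] t) (𝓝 X) := by
    have h := hasDerivAt_iff_tendsto_slope.1 hd.hasDerivAt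
    refine h.congr fun s ↦ ?_
    rw [slope_def_module, hL0, sub_zero]
  have hG' := hG.tendsto.mono_left (nhdsWithin_le_nhds (s := {t}ᶜ))
  have hfut' := hfut.tendsto.mono_left (nhdsWithin_le_nhds (s := {t}ᶜ))
  have hlim1 := tendsto_clm_apply (tendsto_clm_apply hG' hσ) hσ
  have hlim2 := tendsto_clm_apply (tendsto_clm_apply hG' hfut') hσ
  rw [coordMetric_self] at hlim1 hlim2
  rw [show tangentCoord (γ t) (γ t) (S.future (γ t)) = S.future (γ t) from
    tangentCoord_self _ _] at hlim2
  have hXnull : S.form (γ t) X X = 0 := by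
    refine tendsto_nhds_unique_of_eventuallyEq hlim1 tendsto_const_nhds ?_
    filter_upwards [nhdsWithin_le_nhds hnull,
      nhdsWithin_le_nhds (eventually_mem_chart (E := E) hγ.continuousAt)] with s hs hs'
    rw [S.metric_eq_coordMetric hs'] at hs
    rw [map_smul, map_smul, smul_apply, show S.coordMetric (γ t) _ (L s) (L s) = 0 from hs]
    simp
  have hpos : ∀ᶠ s in 𝓝 t, 0 ≤ S.coordMetric (γ t) (extChartAt 𝓘(ℝ, E) (γ t) (γ s))
      (tangentCoord (γ t) (γ s) (S.future (γ s))) (L s) := by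
    filter_upwards [hpast, hfutV] with s hs hs'
    rwa [hs'] at hs
  -- The factor (s - t)⁻¹ changes sign at `t`: from the right the quotients are past-pointing or
  -- zero, from the left future-pointing or zero. Hence `X` is orthogonal to `future`, and being
  -- lightlike it is zero.
  have hge : 0 ≤ S.form (γ t) (S.future (γ t)) X := by
    refine ge_of_tendsto (hlim2.mono_left (nhdsWithin_mono t (fun s hs ↦ ne_of_gt hs) :
      𝓝[>] t ≤ 𝓝[≠] t)) ?_
    filter_upwards [nhdsWithin_le_nhds hpos, self_mem_nhdsWithin] with s hs hs'
    rw [map_smul, smul_eq_mul]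
    exact mul_nonneg (inv_nonneg.2 (sub_nonneg.2 (le_of_lt hs'))) hs
  have hle : S.form (γ t) (S.future (γ t)) X ≤ 0 := by
    refine le_of_tendsto (hlim2.mono_left (nhdsWithin_mono t (fun s hs ↦ ne_of_lt hs) :
      𝓝[<] t ≤ 𝓝[≠] t)) ?_
    filter_upwards [nhdsWithin_le_nhds hpos, self_mem_nhdsWithin] with s hs hs'
    rw [map_smul, smul_eq_mul]
    exact mul_nonpos_of_nonpos_of_nonneg (inv_nonpos.2 (sub_nonpos.2 (le_of_lt hs'))) hs
  refine hcov.trans ?_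
  by_contra hne
  exact S.metric_ne_zero_of_null (x := γ t) (S.metric_future _) hXnull hne (le_antisymm hle hge)

end Vertex

/-! ### Solving the constraint for the rate of the particle's proper time -/

section RelativeVelocity

/-- The covariant derivative `∇_u (log q)` at `p`, when `q` moves with the velocity `c • u'`. -/
def logCovDeriv (p q : M) (u u' : E) (c : ℝ) : E :=
  S.logDeriv p q (u, 0) + c • S.logDeriv p q (0, u') + S.christoffel p u (S.log p q)

/-- The value of `c` with `g(logCovDeriv c, n) + k = 0`. -/
def logRate (p q : M) (u u' n : E) (k : ℝ) : ℝ :=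
  -(S.form p (S.logCovDeriv p q u u' 0) n + k) / S.form p (S.logDeriv p q (0, u')) n

variable {S}

theorem eq_logRate {p q : M} {u u' n : E} {k c : ℝ} (hne : S.form p (S.logDeriv p q (0, u')) n ≠ 0)
    (h : S.form p (S.logCovDeriv p q u u' c) n + k = 0) : c = S.logRate p q u u' n k := by
  rw [logRate, eq_div_iff hne]
  simp only [logCovDeriv, map_add, map_smul, add_apply, smul_apply, smul_eq_mul] at h ⊢
  linarith

variable (S)

open Classical in
/-- The covariant derivative `∇_u (log q)` at `p`, when `q` moves with a velocity proportional to
`u'` on the past light cones of an observer with the velocity `u`. -/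
def lightCovDeriv (p q : M) (u u' : E) : E :=
  if p = q then 0 else S.logCovDeriv p q u u' (S.logRate p q u u' (S.log p q) 0)

theorem lightCovDeriv_of_eq {p q : M} (h : p = q) (u u' : E) : S.lightCovDeriv p q u u' = 0 :=
  if_pos h

theorem lightCovDeriv_of_ne {p q : M} (h : p ≠ q) (u u' : E) : S.lightCovDeriv p q u u' =
    S.logCovDeriv p q u u' (S.logRate p q u u' (S.log p q) 0) :=
  if_neg h

/-- The covariant derivative `∇_u S_obs` at `p`, where `a` is the acceleration of the observer. -/
def obsCovDeriv (p q : M) (u a u' : E) : E :=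
  S.lightCovDeriv p q u u' +
    (S.form p (S.lightCovDeriv p q u u') u + S.form p (S.log p q) a) • u +
    S.form p (S.log p q) u • a

/-- The projection of `v` onto the orthogonal space of `u`. -/
def projOrthogonal (p : M) (u v : E) : E := v + S.form p v u • u

variable {S}

theorem IsWorldLine.contMDiffAt {β : ℝ → M} {I : Set ℝ} (h : S.IsWorldLine β I) {t : ℝ}
    (ht : t ∈ I) : ContMDiffAt 𝓘(ℝ, ℝ) 𝓘(ℝ, E) ∞ β t :=
  h.contMDiffOn.contMDiffAt (h.isOpen.mem_nhds ht)

theorem IsWorldLine.velocity_differentiable {β : ℝ → M} {I : Set ℝ} (h : S.IsWorldLine β I) {t : ℝ}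
    (ht : t ∈ I) : CurveFieldDifferentiableAt β (fun s ↦ curveVelocity (E := E) β s) t :=
  curveVelocity_differentiable ((h.contMDiffAt ht).of_le ENat.LEInfty.out)

variable [FiniteDimensional ℝ E]

/-- Differentiating g(S, U) = 0 along β gives an affine equation for f'(τ), solvable by the crossing
condition. -/
theorem IsConvexNormal.covDeriv_relPositionField_of_isSimultaneous (hS : S.IsConvexNormal)
    {β β' : ℝ → M} {I I' : Set ℝ} {f : ℝ → ℝ} {τ : ℝ}
    (hβ : S.IsWorldLine β I) (hβ' : S.IsWorldLine β' I') (hτ : τ ∈ I) (hf : DifferentiableAt ℝ f τ)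
    (hsim : ∀ᶠ t in 𝓝 τ, f t ∈ I' ∧ S.IsSimultaneous (β t) (curveVelocity β t) (β' (f t)))
    (hcross : S.CrossesSimultaneity (β τ) (curveVelocity β τ) β' (f τ)) :
    CurveFieldDifferentiableAt β (S.relPositionField β β' f) τ ∧
      @Eq E (S.covDeriv β (S.relPositionField β β' f) τ)
        (S.logCovDeriv (β τ) (β' (f τ)) (curveVelocity β τ) (curveVelocity β' (f τ))
          (S.logRate (β τ) (β' (f τ)) (curveVelocity β τ) (curveVelocity β' (f τ))
            (curveVelocity β τ) (S.form (β τ) (S.relPositionField β β' f τ)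
              (S.acceleration β τ)))) := by
  have hβd := (hβ.contMDiffAt hτ).mdifferentiableAt (by simp)
  have hβ'd := (hβ'.contMDiffAt hsim.self_of_nhds.1).mdifferentiableAt (by simp)
  obtain ⟨hd, hcov⟩ := hS.relPositionField_differentiable hβd hβ'd hf
  refine ⟨hd, hcov.trans (congrArg (S.logCovDeriv _ _ _ _) (eq_logRate ?_ ?_))⟩
  · have h1 : HasDerivAt (fun t ↦ S.metric (β τ) (S.log (β τ) (β' t)) (curveVelocity β τ)) _
        (f τ) :=
      ((S.form (β τ)).flip (curveVelocity β τ)).hasFDerivAt.comp_hasDerivAt (f τ)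
        (hS.hasDerivAt_log (β τ) hβ'd)
    rw [CrossesSimultaneity, h1.deriv] at hcross
    exact hcross
  · have h1 : (fun t ↦ S.metric (β t) (S.relPositionField β β' f t) (curveVelocity β t)) =ᶠ[𝓝 τ]
        fun _ ↦ 0 := by
      filter_upwards [hsim] with t ht
      obtain ⟨v, hv, -, hvu⟩ := ht.2
      rw [relPositionField, hS.log_eq hv, hvu]
    have h2 := (S.hasDerivAt_metric hd (hβ.velocity_differentiable hτ)).unique
      ((hasDerivAt_const τ (0 : ℝ)).congr_of_eventuallyEq h1)
    rw [S.metric_eq_form, hcov] at h2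
    exact h2

/-- Away from the vertex, differentiating g(S, S) = 0 determines f'(τ). At the vertex that equation
is trivial, and the covariant derivative vanishes for reasons of time orientation. -/
theorem IsConvexNormal.covDeriv_relPositionField_of_isLightRay (hS : S.IsConvexNormal)
    {β β' : ℝ → M} {I I' : Set ℝ} {f : ℝ → ℝ} {τ : ℝ}
    (hβ : S.IsWorldLine β I) (hβ' : S.IsWorldLine β' I') (hτ : τ ∈ I) (hf : DifferentiableAt ℝ f τ)
    (hray : ∀ᶠ t in 𝓝 τ, f t ∈ I' ∧ S.IsLightRay (β' (f t)) (β t)) :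
    CurveFieldDifferentiableAt β (S.relPositionField β β' f) τ ∧
      @Eq E (S.covDeriv β (S.relPositionField β β' f) τ)
        (S.lightCovDeriv (β τ) (β' (f τ)) (curveVelocity β τ) (curveVelocity β' (f τ))) := by
  have hmem := hray.self_of_nhds.1
  have hβd := (hβ.contMDiffAt hτ).mdifferentiableAt (by simp)
  have hβ'd := (hβ'.contMDiffAt hmem).mdifferentiableAt (by simp)
  obtain ⟨hd, hcov⟩ := hS.relPositionField_differentiable hβd hβ'd hf
  have hnull : ∀ᶠ t in 𝓝 τ, S.metric (β t) (S.relPositionField β β' f t)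
      (S.relPositionField β β' f t) = 0 ∧
      0 ≤ S.metric (β t) (S.future (β t)) (S.relPositionField β β' f t) := by
    filter_upwards [hray] with t ht
    by_cases h : β' (f t) = β t
    · rw [relPositionField, h, hS.log_self]
      simp
    · have h1 := hS.log_of_isLightRay ht.2 h
      exact ⟨h1.2.1, h1.2.2.le⟩
  refine ⟨hd, ?_⟩
  by_cases hpq : β τ = β' (f τ)
  · refine Eq.trans ?_ (S.lightCovDeriv_of_eq hpq _ _).symm
    refine covDeriv_eq_zero_of_null hd ?_ (hnull.mono fun _ h ↦ h.1) (hnull.mono fun _ h ↦ h.2)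
    rw [relPositionField, ← hpq, hS.log_self]
  · refine Eq.trans ?_ (S.lightCovDeriv_of_ne hpq _ _).symm
    have hlog := hS.log_of_isLightRay hray.self_of_nhds.2 (Ne.symm hpq)
    refine hcov.trans (congrArg (S.logCovDeriv _ _ _ _) (eq_logRate ?_ ?_))
    · refine hS.form_logDeriv_ne_zero (hβ'.contMDiffAt hmem) ?_ hlog.2.1 hlog.1
      rw [hβ'.unit _ hmem]
      norm_num
    · have h2 := (S.hasDerivAt_metric hd hd).unique
        ((hasDerivAt_const τ (0 : ℝ)).congr_of_eventuallyEq (hnull.mono fun _ h ↦ h.1))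
      rw [S.metric_symm _ (S.relPositionField β β' f τ), S.metric_eq_form, hcov] at h2
      -- The derivative of g(S, S) is twice g(∇_U S, S); the light constraint is the case k = 0 of
      -- `eq_logRate`.
      have h3 : ∀ a : ℝ, a + a = 0 → a + 0 = 0 := fun a h ↦ by linarith
      exact h3 _ h2

end RelativeVelocity

end Spacetime

end

/-! ### The two relative velocities -/

theorem proposition3p3 {E : Type*} [NormedAddCommGroup E] [NormedSpace ℝ E] [FiniteDimensional ℝ E]
    {M : Type*} [TopologicalSpace M] [T2Space M] [ChartedSpace E M] [IsManifold 𝓘(ℝ, E) ∞ M]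
    (S : Spacetime E M) (hS : S.IsConvexNormal) :
    (∃ Φ : ∀ (p q : M) (_u _a : TangentSpace 𝓘(ℝ, E) p) (_u' : TangentSpace 𝓘(ℝ, E) q)
        (_s : TangentSpace 𝓘(ℝ, E) p), TangentSpace 𝓘(ℝ, E) p,
      ∀ (β β' : ℝ → M) (I I' : Set ℝ) (f : ℝ → ℝ) (τ : ℝ),
        S.IsWorldLine β I → S.IsWorldLine β' I' → τ ∈ I → DifferentiableAt ℝ f τ →
        (∀ᶠ t in 𝓝 τ, f t ∈ I' ∧ S.IsSimultaneous (β t) (curveVelocity β t) (β' (f t))) →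
        S.CrossesSimultaneity (β τ) (curveVelocity β τ) β' (f τ) →
        CurveFieldDifferentiableAt β (S.relPositionField β β' f) τ ∧
        S.fermiVelocity β β' f τ =
          Φ (β τ) (β' (f τ)) (curveVelocity β τ) (S.acceleration β τ)
            (curveVelocity β' (f τ)) (S.relPositionField β β' f τ)) ∧
    (∃ Φ : ∀ (p q : M) (_u _a : TangentSpace 𝓘(ℝ, E) p) (_u' : TangentSpace 𝓘(ℝ, E) q)
        (_s : TangentSpace 𝓘(ℝ, E) p), TangentSpace 𝓘(ℝ, E) p,
      ∀ (β β' : ℝ → M) (I I' : Set ℝ) (f : ℝ → ℝ) (τ : ℝ),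
        S.IsWorldLine β I → S.IsWorldLine β' I' → τ ∈ I → DifferentiableAt ℝ f τ →
        (∀ᶠ t in 𝓝 τ, f t ∈ I' ∧ S.IsLightRay (β' (f t)) (β t)) →
        CurveFieldDifferentiableAt β (S.obsPositionField β β' f) τ ∧
        S.astrometricVelocity β β' f τ =
          Φ (β τ) (β' (f τ)) (curveVelocity β τ) (S.acceleration β τ)
            (curveVelocity β' (f τ)) (S.obsPositionField β β' f τ)) := by
  constructor
  · refine ⟨fun p q u a u' s ↦ S.projOrthogonal p u
      (S.logCovDeriv p q u u' (S.logRate p q u u' u (S.form p s a))), ?_⟩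
    intro β β' I I' f τ hβ hβ' hτ hf hsim hcross
    obtain ⟨hd, hcov⟩ :=
      hS.covDeriv_relPositionField_of_isSimultaneous hβ hβ' hτ hf hsim hcross
    exact ⟨hd, congrArg (S.projOrthogonal (β τ) (curveVelocity β τ)) hcov⟩
  · refine ⟨fun p q u a u' _ ↦ S.projOrthogonal p u (S.obsCovDeriv p q u a u'), ?_⟩
    intro β β' I I' f τ hβ hβ' hτ hf hray
    obtain ⟨hd, hcov⟩ := hS.covDeriv_relPositionField_of_isLightRay hβ hβ' hτ hf hray
    have hU := hβ.velocity_differentiable hτ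
    -- S_obs = S + g(S, U) U; compatibility differentiates the coefficient, which is where the
    -- acceleration enters.
    obtain ⟨hd', hcov'⟩ := S.covDeriv_add_smul hd hU (S.hasDerivAt_metric hd hU)
    refine ⟨hd', (congrArg (S.projOrthogonal (β τ) (curveVelocity β τ)) hcov').trans ?_⟩
    simp only [S.metric_eq_form]
    rw [hcov]
    rfl
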